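/- Let $f:\mathbb{R}^n\to\mathbb{R}$ be convex and differentiable, with $|\nabla_i f(x+ue_i)-\nabla_i f(x)|\le L_i|u|$ for all $x\in\mathbb{R}^n$, $u\in\mathbb{R}$ and $i=1,\dots,n$, and with $L$-Lipschitz gradient. Let $x_*$ be a minimizer of $f$, let $x_0\in\mathbb{R}^n$ with $R=\|x_0-x_*\|_2>0$, and assume that $\overline{L}=\frac1n\sum_{i=1}^n L_i>0$. The Accelerated Meta-algorithm with coordinate descent as inner method, with parameter $H>0$, $M$ outer iterations and $N$ inner iterations, is the following. Put $\lambda=\frac{1}{2H}$, $A_0=0$, $v_0=x_0$. For $k=0,\dots,M-1$ put $a_{k+1}=\frac12\bigl(\lambda+\sqrt{\lambda^2+4\lambda A_k}\bigr)$, $A_{k+1}=A_k+a_{k+1}$ and $\widetilde{x}_k=\frac{A_kv_k+a_{k+1}x_k}{A_{k+1}}$. Starting from $y=\widetilde{x}_k$, perform $N$ times the step: draw an index $i$ with probability $(H+L_i)/Z$, where $Z=\sum_{j=1}^n(H+L_j)$, and replace the coordinate $y^i$ by $y^i-\frac{1}{H+L_i}\bigl(\nabla_i f(y)+H(y^i-\widetilde{x}_k^i)\bigr)$.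 Let $v_{k+1}$ be the resulting point $y$ and put $x_{k+1}=x_k-a_{k+1}\nabla f(v_{k+1})$. The output is $v_M$. For $\varepsilon>0$ and $0<\delta<1$ run this algorithm with $H=\overline{L}$, $$M=\left\lceil\frac{4\sqrt{15}}{5}\sqrt{\frac{HR^2}{\varepsilon}}\right\rceil,\qquad N=\left\lceil\frac{Z}{H}\ln\left\{\frac{M}{\delta}\left(1+\frac LH\right)\left(3+\frac{2L}{H}\right)^2\right\}\right\rceil .$$ Count as one step every arithmetic operation on real numbers (including the square root), every access to a memory cell, every draw from a tabulated distribution and every loop iteration; tabulating a distribution on $n$ points takes $n$ steps. Then $\Pr\bigl(f(v_M)-f(x_*)<\varepsilon\bigr)\ge 1-\delta$. Moreover, if computing one component of the gradient of $f$ takes $O(s)$ steps, $s\ge1$, then the total number $T$ of steps satisfies $$T=O\left(s\cdot n\cdot\sqrt{\frac{\overline{L}\,\|x_0-x_*\|_2^2}{\varepsilon}}\;\log\left\{\frac{1}{\varepsilon^{1/2}\delta}\right\}\right)\qquad\text{as }\varepsilon\to0 .$$ More precisely, for every $c$ there is a constant $C$ depending only on $c$, and for all $L$, $\overline{L}$,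 $R$ there is a threshold $\varepsilon_0>0$ depending only on $c$, $L$, $\overline{L}$, $R$, such that, if each gradient component is computed in at most $c\,s$ steps, then every run with $0<\varepsilon<\varepsilon_0$ and $0<\delta<1$ takes at most $C\,s\,n\,\sqrt{\overline{L}R^2/\varepsilon}\,\log\bigl(1/(\varepsilon^{1/2}\delta)\bigr)$ steps. -/

import Mathlib

open scoped ENNReal

/-! ## A small imperative language over exact real arithmetic, with a step count

Memory consists of real variables, real arrays of length `n`, one table holding a discrete
distribution on `{0, …, n - 1}`, and a clock that counts elementary steps. -/

namespace AccMeta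

/-- Names of the real variables. -/
inductive Scal
  | H | Z | lam | A | Anew | a | g
  deriving DecidableEq

/-- Names of the arrays of length `n`. -/
inductive Arr
  | L | p | x | v | xt | y
  deriving DecidableEq

/-- Contents of the memory, together with the clock. -/
structure Config (n : ℕ) where
  scal : Scal → ℝ
  arr : Arr → Fin n → ℝ
  tab : Fin n → ℝ
  time : ℕ

/-- Advance the clock by `k` steps. -/
def Config.tick {n : ℕ} (σ : Config n) (k : ℕ) : Config n :=
  { σ with time := σ.time + k }

/-- Write the value `t` to the real variable `r`. -/
def Config.setScal {n : ℕ} (σ : Config n) (r : Scal) (t : ℝ) : Config n :=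
  { σ with scal := Function.update σ.scal r t }

/-- Write the value `t` to the entry `b[i]`. -/
def Config.setEntry {n : ℕ} (σ : Config n) (b : Arr) (i : Fin n) (t : ℝ) : Config n :=
  { σ with arr := Function.update σ.arr b (Function.update (σ.arr b) i t) }

/-- Arithmetic terms. -/
inductive Arith (n : ℕ)
  | lit (k : ℕ)
  | var (r : Scal)
  | entry (b : Arr) (i : Fin n)
  | add (e₁ e₂ : Arith n)
  | sub (e₁ e₂ : Arith n)
  | mul (e₁ e₂ : Arith n)
  | div (e₁ e₂ : Arith n)
  | sqrt (e : Arith n)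

/-- The value of a term. -/
noncomputable def Arith.value {n : ℕ} (σ : Config n) : Arith n → ℝ
  | .lit k => (k : ℝ)
  | .var r => σ.scal r
  | .entry b i => σ.arr b i
  | .add e₁ e₂ => e₁.value σ + e₂.value σ
  | .sub e₁ e₂ => e₁.value σ - e₂.value σ
  | .mul e₁ e₂ => e₁.value σ * e₂.value σ
  | .div e₁ e₂ => e₁.value σ / e₂.value σ
  | .sqrt e => Real.sqrt (e.value σ)

/-- The number of steps needed to evaluate a term: one for every literal, every memory access and
every arithmetic operation. -/
def Arith.cost {n : ℕ} : Arith n → ℕ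
  | .lit _ => 1
  | .var _ => 1
  | .entry _ _ => 1
  | .add e₁ e₂ => e₁.cost + e₂.cost + 1
  | .sub e₁ e₂ => e₁.cost + e₂.cost + 1
  | .mul e₁ e₂ => e₁.cost + e₂.cost + 1
  | .div e₁ e₂ => e₁.cost + e₂.cost + 1
  | .sqrt e => e.cost + 1

/-- Programs. -/
inductive Prog (n : ℕ)
  /-- `r ← e` -/
  | setScal (r : Scal) (e : Arith n)
  /-- `b[i] ← e`, in place -/
  | setEntry (b : Arr) (i : Fin n) (e : Arith n)
  /-- `r ← ∇ᵢ f(b)`, the `i`-th component of the gradient of the objective at the point `b` -/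
  | gradComp (r : Scal) (b : Arr) (i : Fin n)
  /-- tabulate the discrete distribution with weights `b` -/
  | tabulate (b : Arr)
  /-- draw an index `i` from the tabulated distribution, then execute `body i` -/
  | draw (body : Fin n → Prog n)
  /-- sequential composition -/
  | seq (c d : Prog n)
  /-- execute `c` exactly `N` times -/
  | loop (N : ℕ) (c : Prog n)
  /-- `for i = 0, …, n - 1 do body i` -/
  | forCoords (body : Fin n → Prog n)

/-- The law of the final memory contents when a program is started from given memory contents.
Here `f` is the objective and `τ z i` is the number of steps spent on computing `∇ᵢ f(z)`.
An assignment costs one step more than the evaluation of its right-hand side, tabulating a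
distribution on `n` points costs `n` steps, a draw from the tabulated distribution costs one step,
and every passage through the body of a loop costs one step in addition to the steps of the body.
A draw from a table without positive weights has no effect. -/
noncomputable def Prog.run {n : ℕ} (f : EuclideanSpace ℝ (Fin n) → ℝ)
    (τ : EuclideanSpace ℝ (Fin n) → Fin n → ℕ) : Prog n → Config n → PMF (Config n)
  | .setScal r e, σ => PMF.pure ((σ.setScal r (e.value σ)).tick (e.cost + 1))
  | .setEntry b i e, σ => PMF.pure ((σ.setEntry b i (e.value σ)).tick (e.cost + 1))
  | .gradComp r b i, σ =>
      PMF.pure ((σ.setScal r (gradient f (WithLp.toLp 2 (σ.arr b)) i)).tick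
        (τ (WithLp.toLp 2 (σ.arr b)) i + 1))
  | .tabulate b, σ => PMF.pure ({ σ with tab := σ.arr b }.tick n)
  | .draw body, σ =>
      if h : ∑' i, ENNReal.ofReal (σ.tab i) ≠ 0 then
        (PMF.normalize (fun i => ENNReal.ofReal (σ.tab i)) h (by
          rw [tsum_fintype]
          exact ENNReal.sum_ne_top.2 fun _ _ => ENNReal.ofReal_ne_top)).bind
            fun i => (body i).run f τ (σ.tick 1)
      else PMF.pure (σ.tick 1)
  | .seq c d, σ => (c.run f τ σ).bind fun ρ => d.run f τ ρ
  | .loop N c, σ =>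
      Nat.rec (PMF.pure σ) (fun _ q => q.bind fun ρ => c.run f τ (ρ.tick 1)) N
  | .forCoords body, σ =>
      (List.finRange n).foldl (fun q i => q.bind fun ρ => (body i).run f τ (ρ.tick 1)) (PMF.pure σ)

/-! ## The algorithm -/

/-- Coordinate descent with `N` iterations for the auxiliary function
`F(y) = f(y) + (H / 2) ‖y - x̃‖²`, started from `y = x̃`:
draw `i` with probability `(H + Lᵢ) / Z`, then `yᵢ ← yᵢ - (1 / (H + Lᵢ)) ∇ᵢ F(y)`. -/
def coordinateDescent (n N : ℕ) : Prog n :=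
  .seq (.forCoords fun i => .setEntry .y i (.entry .xt i))
    (.loop N (.draw fun i =>
      .seq (.gradComp .g .y i)
        (.setEntry .y i
          (.sub (.entry .y i)
            (.mul (.div (.lit 1) (.add (.var .H) (.entry .L i)))
              (.add (.var .g)
                (.mul (.var .H) (.sub (.entry .y i) (.entry .xt i)))))))))

/-- One iteration of the accelerated meta-algorithm whose inner method makes `N` iterations. -/
def outerStep (n N : ℕ) : Prog n :=
  -- a ← (λ + √(λ² + 4 λ A)) / 2
  .seq (.setScal .a
    (.div (.add (.var .lam)
      (.sqrt (.add (.mul (.var .lam) (.var .lam))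
        (.mul (.lit 4) (.mul (.var .lam) (.var .A)))))) (.lit 2))) <|
  -- A_new ← A + a
  .seq (.setScal .Anew (.add (.var .A) (.var .a))) <|
  -- x̃ ← (A v + a x) / A_new
  .seq (.forCoords fun i => .setEntry .xt i
    (.div (.add (.mul (.var .A) (.entry .v i)) (.mul (.var .a) (.entry .x i))) (.var .Anew))) <|
  -- v ← approximate minimizer of the auxiliary function
  .seq (coordinateDescent n N) <|
  .seq (.forCoords fun i => .setEntry .v i (.entry .y i)) <|
  -- x ← x - a ∇f(v)
  .seq (.forCoords fun i => .seq (.gradComp .g .v i)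
    (.setEntry .x i (.sub (.entry .x i) (.mul (.var .a) (.var .g))))) <|
  .setScal .A (.var .Anew)

/-- The preliminary computations: `λ ← 1 / (2H)`, `A ← 0`, `v ← x`, `Z ← ∑ᵢ (H + Lᵢ)`,
`pᵢ ← (H + Lᵢ) / Z`, and the table of the distribution with the probabilities `pᵢ`. -/
def preliminaries (n : ℕ) : Prog n :=
  .seq (.setScal .lam (.div (.lit 1) (.mul (.lit 2) (.var .H)))) <|
  .seq (.setScal .A (.lit 0)) <|
  .seq (.forCoords fun i => .setEntry .v i (.entry .x i)) <|
  .seq (.setScal .Z (.lit 0)) <|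
  .seq (.forCoords fun i => .setScal .Z (.add (.var .Z) (.add (.var .H) (.entry .L i)))) <|
  .seq (.forCoords fun i => .setEntry .p i
    (.div (.add (.var .H) (.entry .L i)) (.var .Z))) <|
  .tabulate .p

/-- The accelerated meta-algorithm with `M` outer iterations and with `N` iterations of coordinate
descent for each auxiliary problem. Its output is the array `v`. -/
def metaAlgorithm (n M N : ℕ) : Prog n :=
  .seq (preliminaries n) (.loop M (outerStep n N))

/-- The initial memory: the inputs are `H`, the constants `Lᵢ` and the starting point `x₀`. -/
noncomputable def initial {n : ℕ} (H : ℝ) (Lc : Fin n → ℝ) (x₀ : EuclideanSpace ℝ (Fin n)) :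
    Config n where
  scal := fun r => if r = .H then H else 0
  arr := fun b => if b = .L then Lc else if b = .x then x₀.ofLp else 0
  tab := 0
  time := 0

/-- The output of the algorithm. -/
def Config.output {n : ℕ} (σ : Config n) : EuclideanSpace ℝ (Fin n) :=
  WithLp.toLp 2 (σ.arr .v)

/-- The number of outer iterations, `⌈(4√15 / 5) √(H R² / ε)⌉`. -/
noncomputable def outerIterations (H R ε : ℝ) : ℕ :=
  ⌈4 * Real.sqrt 15 / 5 * Real.sqrt (H * R ^ 2 / ε)⌉₊

/-- The number of iterations of coordinate descent for each auxiliary problem,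
`⌈(Z / H) ln ((M / δ) (1 + L / H) (3 + 2 L / H)²)⌉` with `Z = ∑ᵢ (H + Lᵢ)`, where `M` is the
number of outer iterations. -/
noncomputable def innerIterations {n : ℕ} (H L : ℝ) (Lc : Fin n → ℝ) (M : ℕ) (δ : ℝ) : ℕ :=
  ⌈(∑ i, (H + Lc i)) / H * Real.log ((M : ℝ) / δ * (1 + L / H) * (3 + 2 * L / H) ^ 2)⌉₊

end AccMeta

/-! Write F for the auxiliary function of an outer iteration, z = x̃ₖ for its centre, w for its
minimizer, and K = (1 + L/H)(3 + 2L/H)². The proof combines a deterministic estimate, a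
probabilistic one and a step count.

Deterministic part: if the inner output y satisfies ‖λ∇f(y) + (y - z)‖ ≤ ‖y - z‖ with λ = 1/(2H),
then the potential A(f(v) - f(x_*)) + ½‖x - x_*‖² does not increase (`potential_le_of_norm_le`). As
Aₖ ≥ λk²/4 (`weight_growth`), this gives M²(f(v_M) - f(x_*)) ≤ 4HR², while the choice of M makes M²ε
at least (48/5)HR².

Probabilistic part: the criterion holds as soon as the gap of F has shrunk by the factor K
(`norm_smul_gradient_add_le_of_gap_le`). Each coordinate step contracts the expected gap by 1 - H/Z
(`sum_proxObjective_step_le`), so N steps contract it by δ/(MK). By Markov's inequality one outer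
iteration fails with probability at most δ/M (`ensures_coordinateDescent`). This holds from every
memory state satisfying the outer invariant, so a union bound over the M iterations gives δ without
any independence argument.

Step count: a syntactic worst-case cost bounds every run (`ensures_time_le`). For H = L̄ one has Z/H
= 2n, and for small ε the logarithm in N is at most 2 log(1/(√ε δ)) (`log_factor_le`). -/

namespace AccMeta

/-! ### Convex analysis: the auxiliary function, the inner stopping criterion and the potential -/

section Analysis

variable {E : Type*} [NormedAddCommGroup E] [InnerProductSpace ℝ E]

/-- The auxiliary function `F(y) = f(y) + (H / 2) ‖y - z‖²`. -/
noncomputable def proxObjective (f : E → ℝ) (H : ℝ) (z y : E) : ℝ := f y + H / 2 * ‖y - z‖ ^ 2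

theorem proxObjective_add_eq (f : E → ℝ) (H : ℝ) (z y v : E) :
    proxObjective f H z (y + v) = f (y + v) + H / 2 * ‖y - z‖ ^ 2 + H * inner ℝ (y - z) v
      + H / 2 * ‖v‖ ^ 2 := by
  rw [proxObjective, show y + v - z = (y - z) + v by abel, norm_add_sq_real]
  ring

theorem exists_proxObjective_min [FiniteDimensional ℝ E] {f : E → ℝ} {H : ℝ} (hf : Differentiable ℝ f) (hH : 0 < H)
    {m : ℝ} (hm : ∀ x, m ≤ f x) (z : E) :
    ∃ w, ∀ y, proxObjective f H z w ≤ proxObjective f H z y := by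
  have : ProperSpace E := FiniteDimensional.proper ℝ E
  apply Continuous.exists_forall_le
  · unfold proxObjective
    have := hf.continuous
    fun_prop
  · have h1 : Filter.Tendsto (fun y : E => ‖y - z‖) (Filter.cocompact E) Filter.atTop :=
      tendsto_norm_cocompact_atTop.comp (Homeomorph.subRight z).isClosedEmbedding.tendsto_cocompact
    have h2 : Filter.Tendsto (fun y : E => m + H / 2 * ‖y - z‖ ^ 2) (Filter.cocompact E)
        Filter.atTop :=
      Filter.tendsto_atTop_add_const_left _ _
        (((Filter.tendsto_pow_atTop two_ne_zero).comp h1).const_mul_atTop (half_pos hH))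
    refine Filter.tendsto_atTop_mono (fun y => ?_) h2
    unfold proxObjective
    linarith [hm y]

variable [CompleteSpace E]

/-- Subtracting g'(0)t + Kt²/2 leaves an antitone function on [0, 1]. This one-dimensional descent
lemma serves both the full Lipschitz bound and the coordinatewise ones. -/
theorem le_add_of_hasDerivAt_of_deriv_sub_le {g g' : ℝ → ℝ} {K : ℝ}
    (hg : ∀ t, HasDerivAt g (g' t) t) (h : ∀ t, 0 ≤ t → g' t - g' 0 ≤ K * t) :
    g 1 ≤ g 0 + g' 0 + K / 2 := by
  have hd : ∀ t, HasDerivAt (fun t => g t - g' 0 * t - K / 2 * t ^ 2)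
      (g' t - g' 0 - K * t) t := by
    intro t
    refine (((hg t).sub ((hasDerivAt_id t).const_mul (g' 0))).sub
      (((hasDerivAt_id t).fun_pow 2).const_mul (K / 2))).congr_deriv ?_
    push_cast
    simp only [id]
    ring
  have hanti : AntitoneOn (fun t => g t - g' 0 * t - K / 2 * t ^ 2) (Set.Icc 0 1) := by
    apply antitoneOn_of_deriv_nonpos (convex_Icc 0 1)
    · exact fun t _ => (hd t).continuousAt.continuousWithinAt
    · exact fun t _ => (hd t).differentiableAt.differentiableWithinAt
    · intro t ht
      rw [interior_Icc] at ht
      rw [(hd t).deriv]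
      linarith [h t ht.1.le]
  have := hanti (Set.left_mem_Icc.2 zero_le_one) (Set.right_mem_Icc.2 zero_le_one) zero_le_one
  simp only at this
  linarith

theorem hasDerivAt_comp_line {f : E → ℝ} (hf : Differentiable ℝ f) (x v : E) (t : ℝ) :
    HasDerivAt (fun t : ℝ => f (x + t • v)) (inner ℝ (gradient f (x + t • v)) v) t := by
  rw [inner_gradient_left]
  have h1 : HasDerivAt (fun t : ℝ => x + t • v) v t := by
    simpa using ((hasDerivAt_id t).smul_const v).const_add x
  exact (hf _).hasFDerivAt.comp_hasDerivAt t h1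

theorem le_add_inner_gradient_of_le {f : E → ℝ} (hf : Differentiable ℝ f) {x v : E} {K : ℝ}
    (h : ∀ t : ℝ, 0 ≤ t → inner ℝ (gradient f (x + t • v)) v - inner ℝ (gradient f x) v ≤ K * t) :
    f (x + v) ≤ f x + inner ℝ (gradient f x) v + K / 2 := by
  simpa using le_add_of_hasDerivAt_of_deriv_sub_le (hasDerivAt_comp_line hf x v)
    (K := K) (by simpa using h)

theorem le_add_inner_gradient_of_lipschitz {f : E → ℝ} {L : ℝ} (hf : Differentiable ℝ f)
    (hL : ∀ x y, ‖gradient f x - gradient f y‖ ≤ L * ‖x - y‖) (x v : E) :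
    f (x + v) ≤ f x + inner ℝ (gradient f x) v + L / 2 * ‖v‖ ^ 2 := by
  have := le_add_inner_gradient_of_le hf (x := x) (v := v) (K := L * ‖v‖ ^ 2) (by
    intro t ht
    rw [← inner_sub_left]
    refine (real_inner_le_norm _ _).trans ?_
    have h1 := hL (x + t • v) x
    rw [add_sub_cancel_left, norm_smul, Real.norm_of_nonneg ht] at h1
    nlinarith [mul_le_mul_of_nonneg_right h1 (norm_nonneg v)])
  linarith

theorem add_inner_gradient_le_of_convexOn {f : E → ℝ} (hf : Differentiable ℝ f)
    (hc : ConvexOn ℝ Set.univ f) (x y : E) :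
    f x + inner ℝ (gradient f x) (y - x) ≤ f y := by
  have hc' : ConvexOn ℝ Set.univ (fun t : ℝ => f (x + t • (y - x))) := by
    have := hc.comp_affineMap (AffineMap.lineMap x y : ℝ →ᵃ[ℝ] E)
    simpa [Function.comp_def, AffineMap.lineMap_apply, add_comm] using this
  have h0 := hasDerivAt_comp_line hf x (y - x) 0
  have := hc'.le_slope_of_hasDerivAt (Set.mem_univ 0) (Set.mem_univ 1) zero_lt_one h0
  simp only [slope_def_field, zero_smul, add_zero, one_smul, add_sub_cancel, sub_zero,
    div_one] at this
  linarith

/-- The gradient of the auxiliary function. -/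
noncomputable def proxGradient (f : E → ℝ) (H : ℝ) (z y : E) : E := gradient f y + H • (y - z)

variable {f : E → ℝ} {H L : ℝ}

theorem inner_proxGradient (z y v : E) :
    inner ℝ (proxGradient f H z y) v = inner ℝ (gradient f y) v + H * inner ℝ (y - z) v := by
  rw [proxGradient, inner_add_left, real_inner_smul_left]

theorem proxObjective_strongly_convex (hf : Differentiable ℝ f) (hc : ConvexOn ℝ Set.univ f)
    (z y v : E) :
    proxObjective f H z y + inner ℝ (proxGradient f H z y) v + H / 2 * ‖v‖ ^ 2
      ≤ proxObjective f H z (y + v) := by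
  have := add_inner_gradient_le_of_convexOn hf hc y (y + v)
  rw [add_sub_cancel_left] at this
  rw [proxObjective_add_eq, inner_proxGradient, proxObjective]
  linarith

theorem proxObjective_add_le (hf : Differentiable ℝ f)
    (hL : ∀ x y, ‖gradient f x - gradient f y‖ ≤ L * ‖x - y‖) (z y v : E) :
    proxObjective f H z (y + v) ≤ proxObjective f H z y + inner ℝ (proxGradient f H z y) v
      + (L + H) / 2 * ‖v‖ ^ 2 := by
  have := le_add_inner_gradient_of_lipschitz hf hL y v
  rw [proxObjective_add_eq, inner_proxGradient, proxObjective]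
  linarith

/-- A gradient step of length 1/(L + H) from w lowers F by at least ‖∇F(w)‖²/(2(L + H)), which
minimality forbids unless the gradient vanishes. -/
theorem proxGradient_eq_zero_of_min (hf : Differentiable ℝ f)
    (hL : ∀ x y, ‖gradient f x - gradient f y‖ ≤ L * ‖x - y‖) (hLH : 0 < L + H) {z w : E}
    (hw : ∀ y, proxObjective f H z w ≤ proxObjective f H z y) : proxGradient f H z w = 0 := by
  set g := proxGradient f H z w with hg
  have h1 := proxObjective_add_le (H := H) hf hL z w (-(1 / (L + H)) • g)
  have h2 := hw (w + -(1 / (L + H)) • g)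
  rw [← hg, inner_smul_right, real_inner_self_eq_norm_sq, norm_smul, mul_pow, Real.norm_eq_abs,
    sq_abs] at h1
  have h3 : -(1 / (L + H)) * ‖g‖ ^ 2 + (L + H) / 2 * ((-(1 / (L + H))) ^ 2 * ‖g‖ ^ 2)
      = -(‖g‖ ^ 2 / (2 * (L + H))) := by
    field_simp
    ring
  have h4 : ‖g‖ ^ 2 / (2 * (L + H)) ≤ 0 := by linarith
  have h5 : ‖g‖ ^ 2 ≤ 0 := by
    by_contra! h
    exact absurd h4 (not_le.2 (by positivity))
  simpa using le_antisymm h5 (sq_nonneg _)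

/-- The Polyak–Łojasiewicz inequality for the auxiliary function. -/
theorem proxObjective_sub_le (hf : Differentiable ℝ f) (hc : ConvexOn ℝ Set.univ f) (hH : 0 < H)
    (z y w : E) :
    2 * H * (proxObjective f H z y - proxObjective f H z w) ≤ ‖proxGradient f H z y‖ ^ 2 := by
  have h1 := proxObjective_strongly_convex (H := H) hf hc z y (w - y)
  rw [add_sub_cancel] at h1
  -- Completing the square: strong convexity gives 2H(F(y) - F(w)) ≤ ‖∇F(y)‖² - ‖∇F(y) + H(w - y)‖².
  have h2 := norm_add_sq_real (proxGradient f H z y) (H • (w - y))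
  rw [inner_smul_right, norm_smul, mul_pow, Real.norm_eq_abs, sq_abs] at h2
  nlinarith [sq_nonneg ‖proxGradient f H z y + H • (w - y)‖]

/-- A point with a small gap of the auxiliary function is a good approximate proximal point. -/
theorem norm_smul_gradient_add_le_of_gap_le (hf : Differentiable ℝ f)
    (hc : ConvexOn ℝ Set.univ f) (hH : 0 < H) (hL0 : 0 ≤ L)
    (hL : ∀ x y, ‖gradient f x - gradient f y‖ ≤ L * ‖x - y‖) {z w y : E}
    (hw : ∀ y, proxObjective f H z w ≤ proxObjective f H z y)
    (hy : (1 + L / H) * (3 + 2 * L / H) ^ 2 * (proxObjective f H z y - proxObjective f H z w)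
      ≤ proxObjective f H z z - proxObjective f H z w) :
    ‖(1 / (2 * H)) • gradient f y + (y - z)‖ ≤ ‖y - z‖ := by
  have hw0 : proxGradient f H z w = 0 :=
    proxGradient_eq_zero_of_min hf hL (by linarith) hw
  have h1 := proxObjective_strongly_convex (H := H) hf hc z w (y - w)
  have h2 := proxObjective_add_le (H := H) hf hL z w (z - w)
  rw [hw0, inner_zero_left, add_sub_cancel] at h1 h2
  have hk : (1 + L / H) * H = L + H := by field_simp; ring
  set κ := L / H with hκ
  have hκ0 : 0 ≤ κ := by positivity
  -- The factor 1 + κ is the condition number (L + H)/H, lost in passing between gaps and squared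
  -- distances to w.
  have h3 : (3 + 2 * κ) ^ 2 * ‖y - w‖ ^ 2 ≤ ‖z - w‖ ^ 2 := by
    have e : 2 * L / H = 2 * κ := by rw [hκ]; ring
    rw [e] at hy
    have h4 : (1 + κ) * (3 + 2 * κ) ^ 2 * (H / 2 * ‖y - w‖ ^ 2) ≤ (L + H) / 2 * ‖z - w‖ ^ 2 := by
      refine le_trans ?_ (hy.trans (by linarith))
      gcongr
      linarith
    have h5 : (L + H) / 2 * ((3 + 2 * κ) ^ 2 * ‖y - w‖ ^ 2) ≤ (L + H) / 2 * ‖z - w‖ ^ 2 := by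
      rw [← hk] at h4 ⊢
      linarith
    exact le_of_mul_le_mul_left h5 (by linarith)
  have h4 : (3 + 2 * κ) * ‖y - w‖ ≤ ‖z - w‖ := by
    rw [← mul_pow] at h3
    exact (pow_le_pow_iff_left₀ (by positivity) (norm_nonneg _) two_ne_zero).1 h3
  have h5 : ‖z - w‖ ≤ ‖y - z‖ + ‖y - w‖ := by
    rw [← norm_neg (y - z)]
    refine le_trans (le_of_eq ?_) (norm_add_le _ _)
    congr 1
    abel
  have h6 : ‖proxGradient f H z y‖ ≤ (L + H) * ‖y - w‖ := by
    have e : proxGradient f H z y = (gradient f y - gradient f w) + H • (y - w) := by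
      rw [← sub_zero (proxGradient f H z y), ← hw0, proxGradient, proxGradient]
      simp only [smul_sub]
      abel
    rw [e]
    refine (norm_add_le _ _).trans ?_
    rw [norm_smul, Real.norm_of_nonneg hH.le]
    linarith [hL y w]
  -- The triangle inequality uses up one of the 3 + 2κ; the remaining 2 + 2κ equals 2(L + H)/H. The
  -- criterion then holds with factor 1/4 + 1/2 < 1.
  have h7 : ‖proxGradient f H z y‖ ≤ H / 2 * ‖y - z‖ := by
    have : (L + H) * ‖y - w‖ = H / 2 * ((2 + 2 * κ) * ‖y - w‖) := by rw [← hk]; ring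
    refine h6.trans (this.le.trans ?_)
    gcongr
    linarith
  have e : (1 / (2 * H)) • gradient f y + (y - z)
      = (1 / (2 * H)) • proxGradient f H z y + (1 / 2 : ℝ) • (y - z) := by
    rw [proxGradient, smul_add, smul_smul, add_assoc, ← add_smul]
    congr 1
    rw [show 1 / (2 * H) * H + 1 / 2 = 1 by field_simp; norm_num, one_smul]
  rw [e]
  refine (norm_add_le _ _).trans ?_
  rw [norm_smul, norm_smul, Real.norm_of_nonneg (by positivity), Real.norm_of_nonneg (by norm_num)]
  have h8 : 1 / (2 * H) * ‖proxGradient f H z y‖ ≤ 1 / (2 * H) * (H / 2 * ‖y - z‖) := by gcongr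
  have h9 : 1 / (2 * H) * (H / 2 * ‖y - z‖) = 1 / 4 * ‖y - z‖ := by field_simp; ring
  linarith [norm_nonneg (y - z)]

/-- The potential function of the accelerated method does not increase. -/
theorem potential_le_of_norm_le (hf : Differentiable ℝ f) (hc : ConvexOn ℝ Set.univ f)
    {A a lam : ℝ} (hA : 0 ≤ A) (ha : 0 < a) (hlam : 0 < lam) (hAa : a ^ 2 = lam * (A + a))
    {v x z y xs : E} (hz : (A + a) • z = A • v + a • x)
    (hy : ‖lam • gradient f y + (y - z)‖ ≤ ‖y - z‖) :
    (A + a) * (f y - f xs) + 1 / 2 * ‖x - a • gradient f y - xs‖ ^ 2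
      ≤ A * (f v - f xs) + 1 / 2 * ‖x - xs‖ ^ 2 := by
  set g := gradient f y with hg
  have h1 := mul_le_mul_of_nonneg_left (add_inner_gradient_le_of_convexOn hf hc y v) hA
  have h2 := mul_le_mul_of_nonneg_left (add_inner_gradient_le_of_convexOn hf hc y xs) ha.le
  rw [← hg] at h1 h2
  have h3 : ‖x - a • g - xs‖ ^ 2 = ‖x - xs‖ ^ 2 - 2 * a * inner ℝ g (x - xs) + a ^ 2 * ‖g‖ ^ 2 := by
    rw [show x - a • g - xs = (x - xs) - a • g by abel, norm_sub_sq_real, inner_smul_right,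
      norm_smul, mul_pow, Real.norm_eq_abs, sq_abs, real_inner_comm]
    ring
  -- The convexity inequalities at v and xs are weighted by A and a so that v and x enter only
  -- through (A + a)z.
  have h4 : A * inner ℝ g (v - y) + a * inner ℝ g (xs - y)
      = -(A + a) * inner ℝ g (y - z) - a * inner ℝ g (x - xs) := by
    rw [← inner_smul_right, ← inner_smul_right, ← inner_smul_right, ← inner_smul_right,
      ← inner_add_right, ← inner_sub_right]
    congr 1
    rw [smul_sub (-(A + a)), neg_smul (A + a) z, hz]
    simp only [smul_sub, add_smul, neg_smul]
    abel
  have h5 : 2 * inner ℝ g (y - z) + lam * ‖g‖ ^ 2 ≤ 0 := by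
    have h6 := pow_le_pow_left₀ (norm_nonneg _) hy 2
    rw [norm_add_sq_real, real_inner_smul_left, norm_smul, mul_pow, Real.norm_eq_abs, sq_abs] at h6
    have h7 : lam * (2 * inner ℝ g (y - z) + lam * ‖g‖ ^ 2) ≤ 0 := by nlinarith
    exact nonpos_of_mul_nonpos_right h7 hlam
  have h8 : (A + a) * (2 * inner ℝ g (y - z) + lam * ‖g‖ ^ 2) ≤ 0 :=
    mul_nonpos_of_nonneg_of_nonpos (by linarith) h5
  -- With a² = λ(A + a), the term a²‖g‖²/2 and the term (A + a)⟨g, y - z⟩ add up to half of the left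
  -- side of `h8`.
  rw [h3, hAa]
  nlinarith

end Analysis

/-! ### Step sizes and growth of the weights -/

theorem step_size_sq {lam A : ℝ} (hlam : 0 < lam) (hA : 0 ≤ A) :
    ((lam + Real.sqrt (lam * lam + 4 * (lam * A))) / 2) ^ 2
      = lam * (A + (lam + Real.sqrt (lam * lam + 4 * (lam * A))) / 2) := by
  have := Real.sq_sqrt (show 0 ≤ lam * lam + 4 * (lam * A) by positivity)
  nlinarith

/-- The square root is at least λk, so the weight grows by at least λ(1 + k)/2, more than the
required λ(2k + 1)/4. -/
theorem weight_growth {lam A k : ℝ} (hlam : 0 < lam) (hA : lam / 4 * k ^ 2 ≤ A) :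
    lam / 4 * (k + 1) ^ 2 ≤ A + (lam + Real.sqrt (lam * lam + 4 * (lam * A))) / 2 := by
  have : lam * k ≤ Real.sqrt (lam * lam + 4 * (lam * A)) := by
    apply Real.le_sqrt_of_sq_le
    nlinarith
  nlinarith

/-! ### Coordinate descent -/

section Coordinate

variable {n : ℕ} {f : EuclideanSpace ℝ (Fin n) → ℝ} {H L : ℝ} {Lc : Fin n → ℝ}

theorem inner_single_right (x : EuclideanSpace ℝ (Fin n)) (i : Fin n) (u : ℝ) :
    inner ℝ x (u • EuclideanSpace.single i (1 : ℝ)) = u * x i := by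
  simp [inner_smul_right, EuclideanSpace.inner_single_right]

theorem norm_smul_single_sq (i : Fin n) (u : ℝ) :
    ‖u • EuclideanSpace.single i (1 : ℝ)‖ ^ 2 = u ^ 2 := by
  simp [norm_smul]

theorem proxObjective_add_single_le (hf : Differentiable ℝ f)
    (hLc : ∀ (i : Fin n) (x : EuclideanSpace ℝ (Fin n)) (u : ℝ),
      |gradient f (x + u • EuclideanSpace.single i (1 : ℝ)) i - gradient f x i| ≤ Lc i * |u|)
    (z y : EuclideanSpace ℝ (Fin n)) (i : Fin n) (u : ℝ) :
    proxObjective f H z (y + u • EuclideanSpace.single i (1 : ℝ))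
      ≤ proxObjective f H z y + u * proxGradient f H z y i + (H + Lc i) / 2 * u ^ 2 := by
  have h1 := le_add_inner_gradient_of_le hf (x := y) (v := u • EuclideanSpace.single i (1 : ℝ))
    (K := Lc i * u ^ 2) (by
      intro t ht
      rw [inner_single_right, inner_single_right, ← mul_sub, smul_smul]
      refine (le_abs_self _).trans ?_
      rw [abs_mul]
      refine (mul_le_mul_of_nonneg_left (hLc i y (t * u)) (abs_nonneg u)).trans ?_
      rw [abs_mul, abs_of_nonneg ht, ← sq_abs u]
      exact le_of_eq (by ring))
  rw [proxObjective_add_eq, norm_smul_single_sq, ← inner_single_right (proxGradient f H z y) i u,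
    inner_proxGradient, proxObjective]
  linarith

/-- A step along coordinate i lowers F by at least (∇ᵢF)²/(2(H + Lᵢ)). The sampling weight cancels H
+ Lᵢ, so the expected decrease is at least ‖∇F‖²/(2Z), and the Polyak–Łojasiewicz inequality bounds
this below by H/Z times the gap. -/
theorem sum_proxObjective_step_le (hf : Differentiable ℝ f) (hc : ConvexOn ℝ Set.univ f)
    (hH : 0 < H) (hLc0 : ∀ i, 0 ≤ Lc i)
    (hLc : ∀ (i : Fin n) (x : EuclideanSpace ℝ (Fin n)) (u : ℝ),
      |gradient f (x + u • EuclideanSpace.single i (1 : ℝ)) i - gradient f x i| ≤ Lc i * |u|)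
    {Z : ℝ} (hZ : Z = ∑ i, (H + Lc i)) (hZ0 : 0 < Z) (z y w : EuclideanSpace ℝ (Fin n)) :
    ∑ i, (H + Lc i) / Z * (proxObjective f H z
        (y + (-(1 / (H + Lc i) * proxGradient f H z y i)) • EuclideanSpace.single i (1 : ℝ))
        - proxObjective f H z w)
      ≤ (1 - H / Z) * (proxObjective f H z y - proxObjective f H z w) := by
  have h1 : ∀ i, (H + Lc i) / Z * (proxObjective f H z
        (y + (-(1 / (H + Lc i) * proxGradient f H z y i)) • EuclideanSpace.single i (1 : ℝ))
        - proxObjective f H z w)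
      ≤ (H + Lc i) * ((proxObjective f H z y - proxObjective f H z w) / Z)
        - 1 / (2 * Z) * (proxGradient f H z y i) ^ 2 := by
    intro i
    have hi : 0 < H + Lc i := by linarith [hLc0 i]
    have h2 := proxObjective_add_single_le (H := H) hf hLc z y i
      (-(1 / (H + Lc i) * proxGradient f H z y i))
    calc _ ≤ (H + Lc i) / Z * (proxObjective f H z y - proxObjective f H z w
        + -(1 / (H + Lc i) * proxGradient f H z y i) * proxGradient f H z y i
        + (H + Lc i) / 2 * (-(1 / (H + Lc i) * proxGradient f H z y i)) ^ 2) := by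
          gcongr
          linarith
      _ = _ := by
          field_simp
          ring
  refine (Finset.sum_le_sum fun i _ => h1 i).trans ?_
  rw [Finset.sum_sub_distrib, ← Finset.sum_mul, ← Finset.mul_sum, ← hZ,
    ← EuclideanSpace.real_norm_sq_eq]
  have h2 := proxObjective_sub_le hf hc hH z y w
  have h3 : Z * ((proxObjective f H z y - proxObjective f H z w) / Z)
      - 1 / (2 * Z) * (2 * H * (proxObjective f H z y - proxObjective f H z w))
      = (1 - H / Z) * (proxObjective f H z y - proxObjective f H z w) := by
    field_simp
  rw [← h3]
  gcongr

end Coordinate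

/-! ### Expectations and failure probabilities -/

section PMF

variable {α β : Type*}

/-- The expectation of a nonnegative function. -/
noncomputable def expect (q : PMF α) (φ : α → ℝ≥0∞) : ℝ≥0∞ := ∑' a, q a * φ a

/-- The property `Q` fails with probability at most `b`. -/
def Ensures (q : PMF α) (b : ℝ≥0∞) (Q : α → Prop) : Prop := q.toOuterMeasure {a | ¬ Q a} ≤ b

theorem expect_pure (a : α) (φ : α → ℝ≥0∞) : expect (PMF.pure a) φ = φ a := by
  rw [expect, tsum_eq_single a]
  · simp
  · intro b hb
    simp [hb]

theorem expect_bind (q : PMF α) (k : α → PMF β) (φ : β → ℝ≥0∞) :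
    expect (q.bind k) φ = ∑' a, q a * expect (k a) φ := by
  simp only [expect, PMF.bind_apply, ← ENNReal.tsum_mul_right, ← ENNReal.tsum_mul_left]
  rw [ENNReal.tsum_comm]
  simp only [mul_assoc]

theorem tsum_mul_le_of_support (q : PMF α) {φ ψ : α → ℝ≥0∞} (h : ∀ a ∈ q.support, φ a ≤ ψ a) :
    ∑' a, q a * φ a ≤ ∑' a, q a * ψ a := by
  refine ENNReal.tsum_le_tsum fun a => ?_
  by_cases ha : a ∈ q.support
  · exact mul_le_mul_right (h a ha) _
  · simp [(q.apply_eq_zero_iff a).2 ha]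

theorem ensures_zero_iff {q : PMF α} {Q : α → Prop} : Ensures q 0 Q ↔ ∀ a ∈ q.support, Q a := by
  rw [Ensures, nonpos_iff_eq_zero, PMF.toOuterMeasure_apply_eq_zero_iff, Set.disjoint_left]
  simp

theorem ensures_pure {a : α} {Q : α → Prop} (b : ℝ≥0∞) (h : Q a) : Ensures (PMF.pure a) b Q := by
  rw [Ensures, PMF.toOuterMeasure_pure_apply]
  simp [h]

theorem Ensures.mono {q : PMF α} {b b' : ℝ≥0∞} {Q Q' : α → Prop} (h : Ensures q b Q) (hb : b ≤ b')
    (hQ : ∀ a, Q a → Q' a) : Ensures q b' Q' :=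
  (MeasureTheory.measure_mono (fun a ha hQa => ha (hQ a hQa) : {a | ¬ Q' a} ⊆ {a | ¬ Q a})).trans (h.trans hb)

theorem Ensures.and {q : PMF α} {a b : ℝ≥0∞} {P Q : α → Prop} (hP : Ensures q a P)
    (hQ : Ensures q b Q) : Ensures q (a + b) fun x => P x ∧ Q x := by
  refine (MeasureTheory.measure_mono ?_).trans
    ((MeasureTheory.measure_union_le {x | ¬ P x} {x | ¬ Q x}).trans (add_le_add hP hQ))
  intro x hx
  by_cases h : P x
  · exact Or.inr fun h' => hx ⟨h, h'⟩
  · exact Or.inl h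

/-- The union bound for sequential composition. -/
theorem Ensures.bind {q : PMF α} {k : α → PMF β} {a b : ℝ≥0∞} {P : α → Prop} {Q : β → Prop}
    (hq : Ensures q a P) (hk : ∀ x, P x → Ensures (k x) b Q) : Ensures (q.bind k) (a + b) Q := by
  classical
  rw [Ensures, PMF.toOuterMeasure_bind_apply]
  have h1 : ∀ x, q x * (k x).toOuterMeasure {y | ¬ Q y}
      ≤ Set.indicator {x | ¬ P x} q x + q x * b := by
    intro x
    by_cases hx : P x
    · exact (mul_le_mul_right (hk x hx) _).trans le_add_self
    · rw [Set.indicator_of_mem (show x ∈ {x | ¬ P x} from hx)]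
      refine le_trans ?_ le_self_add
      refine mul_le_of_le_one_right' (le_trans (MeasureTheory.measure_mono (Set.subset_univ _)) ?_)
      exact ((k x).toOuterMeasure_apply_eq_one_iff Set.univ).2 (Set.subset_univ _) |>.le
  refine (ENNReal.tsum_le_tsum h1).trans ?_
  rw [ENNReal.tsum_add, ENNReal.tsum_mul_right, PMF.tsum_coe, one_mul]
  refine add_le_add ?_ le_rfl
  rwa [Ensures, PMF.toOuterMeasure_apply] at hq

/-- Markov's inequality. -/
theorem ensures_le_of_expect_le {q : PMF α} {φ : α → ℝ≥0∞} {b θ : ℝ≥0∞} (h : expect q φ ≤ b * θ) : Ensures q b fun a => φ a ≤ θ := by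
  classical
  rcases eq_or_ne θ ∞ with rfl | hθ
  · exact (ensures_zero_iff.2 fun _ _ => le_top).mono zero_le (fun _ h => h)
  -- The case θ = 0 is needed: the threshold used later vanishes when the starting point already
  -- minimizes F.
  rcases eq_or_ne θ 0 with rfl | hθ0
  · refine (ensures_zero_iff.2 fun a ha => ?_).mono zero_le (fun _ h => h)
    rw [mul_zero, nonpos_iff_eq_zero, expect, ENNReal.tsum_eq_zero] at h
    exact ((mul_eq_zero.1 (h a)).resolve_left ((q.mem_support_iff a).1 ha)).le
  · have h1 : θ * q.toOuterMeasure {a | ¬ φ a ≤ θ} ≤ expect q φ := by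
      rw [PMF.toOuterMeasure_apply, ← ENNReal.tsum_mul_left]
      refine ENNReal.tsum_le_tsum fun a => ?_
      by_cases ha : φ a ≤ θ
      · rw [Set.indicator_of_notMem (by simpa using ha), mul_zero]
        exact zero_le
      · rw [Set.indicator_of_mem (show a ∈ {a | ¬ φ a ≤ θ} from ha), mul_comm]
        exact mul_le_mul_right (not_le.1 ha).le _
    rw [mul_comm b] at h
    exact (ENNReal.mul_le_mul_iff_right hθ0 hθ).1 (h1.trans h)

theorem one_sub_le_of_ensures {q : PMF α} {b : ℝ≥0∞} {Q : α → Prop} (h : Ensures q b Q) :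
    1 - b ≤ q.toOuterMeasure {a | Q a} := by
  rw [tsub_le_iff_right]
  have h1 : q.toOuterMeasure Set.univ = 1 :=
    (q.toOuterMeasure_apply_eq_one_iff Set.univ).2 (Set.subset_univ _)
  rw [← h1, ← Set.union_compl_self {a | Q a}]
  exact (MeasureTheory.measure_union_le _ _).trans (add_le_add le_rfl h)

end PMF

/-! ### Rules for programs -/

section Rules

variable {n : ℕ} {f : EuclideanSpace ℝ (Fin n) → ℝ} {τ : EuclideanSpace ℝ (Fin n) → Fin n → ℕ}

theorem run_seq (c d : Prog n) (σ : Config n) :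
    (Prog.seq c d).run f τ σ = (c.run f τ σ).bind fun ρ => d.run f τ ρ := by
  simp only [Prog.run]

theorem run_setScal (r : Scal) (e : Arith n) (σ : Config n) :
    (Prog.setScal r e).run f τ σ = PMF.pure ((σ.setScal r (e.value σ)).tick (e.cost + 1)) := by
  simp only [Prog.run]

theorem run_loop_zero (c : Prog n) (σ : Config n) :
    (Prog.loop 0 c).run f τ σ = PMF.pure σ := by
  simp only [Prog.run]
  rfl

theorem run_loop_succ (N : ℕ) (c : Prog n) (σ : Config n) :
    (Prog.loop (N + 1) c).run f τ σ
      = ((Prog.loop N c).run f τ σ).bind fun ρ => c.run f τ (ρ.tick 1) := by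
  simp only [Prog.run]

theorem Ensures.seq {c d : Prog n} {σ : Config n} {a b : ℝ≥0∞} {P Q : Config n → Prop}
    (hc : Ensures (c.run f τ σ) a P) (hd : ∀ ρ, P ρ → Ensures (d.run f τ ρ) b Q) :
    Ensures ((Prog.seq c d).run f τ σ) (a + b) Q := by
  rw [run_seq]
  exact hc.bind hd

theorem Ensures.seq_of_zero {c d : Prog n} {σ : Config n} {b : ℝ≥0∞} {P Q : Config n → Prop}
    (hc : Ensures (c.run f τ σ) 0 P) (hd : ∀ ρ, P ρ → Ensures (d.run f τ ρ) b Q) :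
    Ensures ((Prog.seq c d).run f τ σ) b Q := by
  simpa using hc.seq hd

theorem ensures_setScal_seq {r : Scal} {e : Arith n} {d : Prog n} {σ : Config n} {b : ℝ≥0∞}
    {Q : Config n → Prop}
    (h : Ensures (d.run f τ ((σ.setScal r (e.value σ)).tick (e.cost + 1))) b Q) :
    Ensures ((Prog.seq (.setScal r e) d).run f τ σ) b Q := by
  rwa [run_seq, run_setScal, PMF.pure_bind]

theorem ensures_loop {c : Prog n} {b : ℝ≥0∞} (I : ℕ → Config n → Prop)
    (hstep : ∀ k ρ, I k ρ → Ensures (c.run f τ (ρ.tick 1)) b (I (k + 1))) {σ : Config n}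
    (h0 : I 0 σ) (N : ℕ) : Ensures ((Prog.loop N c).run f τ σ) (N * b) (I N) := by
  induction N with
  | zero =>
    rw [run_loop_zero]
    exact ensures_pure _ h0
  | succ N ih =>
    rw [run_loop_succ, Nat.cast_succ, add_mul, one_mul]
    exact ih.bind (hstep N)

/-- The contraction is only assumed on states satisfying `I`, which suffices because `I` holds on
the whole support. -/
theorem expect_loop_le {c : Prog n} {φ : Config n → ℝ≥0∞} {r : ℝ≥0∞} (I : Config n → Prop)
    (hI : ∀ ρ, I ρ → Ensures (c.run f τ (ρ.tick 1)) 0 I)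
    (hφ : ∀ ρ, I ρ → expect (c.run f τ (ρ.tick 1)) φ ≤ r * φ ρ) {σ : Config n}
    (h0 : I σ) (N : ℕ) : expect ((Prog.loop N c).run f τ σ) φ ≤ r ^ N * φ σ := by
  induction N with
  | zero =>
    rw [run_loop_zero, expect_pure]
    simp
  | succ N ih =>
    rw [run_loop_succ, expect_bind]
    have hN := ensures_loop (fun _ => I) (fun _ => hI) h0 N
    rw [mul_zero] at hN
    refine (tsum_mul_le_of_support _ fun ρ hρ => hφ ρ (ensures_zero_iff.1 hN ρ hρ)).trans ?_
    simp only [mul_left_comm _ r]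
    rw [ENNReal.tsum_mul_left, pow_succ', mul_assoc]
    exact mul_le_mul_right ih _

/-- The invariant is indexed by the list of coordinates already visited; `List.finRange` has no
duplicates, so the next index is always new. -/
theorem ensures_forCoords {body : Fin n → Prog n} (I : List (Fin n) → Config n → Prop)
    (hstep : ∀ l i ρ, i ∉ l → I l ρ → Ensures ((body i).run f τ (ρ.tick 1)) 0 (I (l ++ [i])))
    {σ : Config n} (h0 : I [] σ) :
    Ensures ((Prog.forCoords body).run f τ σ) 0 (I (List.finRange n)) := by
  have key : ∀ l : List (Fin n), l.Nodup →
      Ensures (l.foldl (fun q i => q.bind fun ρ => (body i).run f τ (ρ.tick 1)) (PMF.pure σ)) 0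
        (I l) := by
    intro l
    induction l using List.reverseRecOn with
    | nil => exact fun _ => ensures_pure _ h0
    | append_singleton l i ih =>
      intro hl
      rw [List.nodup_append] at hl
      rw [List.foldl_append, List.foldl_cons, List.foldl_nil, ← add_zero (0 : ℝ≥0∞)]
      exact (ih hl.1).bind fun ρ hρ =>
        hstep l i ρ (fun hi => hl.2.2 i hi i (List.mem_singleton_self i) rfl) hρ
  have := key _ (List.nodup_finRange n)
  simpa only [Prog.run] using this

/-- A loop that assigns a whole array. -/
theorem ensures_forCoords_setEntry (b : Arr) (e : Fin n → Arith n) (σ : Config n)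
    (he : ∀ i ρ, ρ.scal = σ.scal → (∀ b', b' ≠ b → ρ.arr b' = σ.arr b') →
      ρ.arr b i = σ.arr b i → (e i).value ρ = (e i).value σ) :
    Ensures ((Prog.forCoords fun i => .setEntry b i (e i)).run f τ σ) 0 fun ρ =>
      ρ.scal = σ.scal ∧ ρ.tab = σ.tab ∧
        ρ.arr = Function.update σ.arr b fun i => (e i).value σ := by
  have := ensures_forCoords (f := f) (τ := τ) (body := fun i => .setEntry b i (e i)) (σ := σ)
    (fun l ρ => ρ.scal = σ.scal ∧ ρ.tab = σ.tab ∧ (∀ b', b' ≠ b → ρ.arr b' = σ.arr b') ∧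
      (∀ i ∈ l, ρ.arr b i = (e i).value σ) ∧ ∀ i ∉ l, ρ.arr b i = σ.arr b i)
    (by
      rintro l i ρ hi ⟨h1, h2, h3, h4, h5⟩
      simp only [Prog.run]
      apply ensures_pure
      have hv : (e i).value (ρ.tick 1) = (e i).value σ := he i _ h1 h3 (h5 i hi)
      refine ⟨h1, h2, fun b' hb' => ?_, fun j hj => ?_, fun j hj => ?_⟩
      · simp [Config.tick, Config.setEntry, Function.update_of_ne hb', h3 b' hb']
      · by_cases hji : j = i
        · subst hji
          simp [Config.tick, Config.setEntry, ← hv]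
        · have : j ∈ l := by simpa [hji] using hj
          simp [Config.tick, Config.setEntry, Function.update_of_ne hji, h4 j this]
      · simp only [List.mem_append, List.mem_singleton, not_or] at hj
        simp [Config.tick, Config.setEntry, Function.update_of_ne hj.2, h5 j hj.1])
    (by simp)
  refine this.mono le_rfl fun ρ ⟨h1, h2, h3, h4, _⟩ => ⟨h1, h2, ?_⟩
  ext b' i
  by_cases hb : b' = b
  · subst hb
    simp [h4 i (List.mem_finRange i)]
  · rw [h3 b' hb, Function.update_of_ne hb]

theorem expect_draw {body : Fin n → Prog n} {σ : Config n} (h0 : ∀ i, 0 ≤ σ.tab i)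
    (h1 : ∑ i, σ.tab i = 1) (φ : Config n → ℝ≥0∞) :
    expect ((Prog.draw body).run f τ σ) φ
      = ∑ i, ENNReal.ofReal (σ.tab i) * expect ((body i).run f τ (σ.tick 1)) φ := by
  have hs : ∑' i, ENNReal.ofReal (σ.tab i) = 1 := by
    rw [tsum_fintype, ← ENNReal.ofReal_sum_of_nonneg fun i _ => h0 i, h1, ENNReal.ofReal_one]
  have hne : ∑' i, ENNReal.ofReal (σ.tab i) ≠ 0 := by rw [hs]; exact one_ne_zero
  simp only [Prog.run]
  rw [dif_pos hne, expect_bind, tsum_fintype]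
  simp only [PMF.normalize_apply, hs, inv_one, mul_one]

/-- Hypothesis `h0` covers a table without positive weights, so the rule needs nothing about the
table and can serve the step count. -/
theorem ensures_draw {body : Fin n → Prog n} {σ : Config n} {Q : Config n → Prop}
    (h0 : Q (σ.tick 1)) (h : ∀ i, Ensures ((body i).run f τ (σ.tick 1)) 0 Q) :
    Ensures ((Prog.draw body).run f τ σ) 0 Q := by
  simp only [Prog.run]
  split_ifs
  · rw [← add_zero (0 : ℝ≥0∞)]
    exact Ensures.bind (P := fun _ => True) (ensures_zero_iff.2 fun _ _ => trivial) fun i _ => h i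
  · exact ensures_pure _ h0

end Rules

/-! ### The success probability of the algorithm -/

section Algorithm

variable {n : ℕ} {f : EuclideanSpace ℝ (Fin n) → ℝ} {τ : EuclideanSpace ℝ (Fin n) → Fin n → ℕ}

/-- The point stored in an array. -/
def Config.point (σ : Config n) (b : Arr) : EuclideanSpace ℝ (Fin n) := WithLp.toLp 2 (σ.arr b)

theorem toLp_update_sub (y : Fin n → ℝ) (i : Fin n) (u : ℝ) :
    (WithLp.toLp 2 (Function.update y i (y i - u)) : EuclideanSpace ℝ (Fin n))
      = WithLp.toLp 2 y + (-u) • EuclideanSpace.single i (1 : ℝ) := by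
  ext j
  by_cases hj : j = i
  · subst hj
    simp [sub_eq_add_neg]
  · simp [hj]

/-- Memory contents that differ at most in what coordinate descent modifies. -/
structure Config.AgreesOffInner (σ ρ : Config n) : Prop where
  scal : ∀ r, r ≠ .g → ρ.scal r = σ.scal r
  tab : ρ.tab = σ.tab
  arr : ∀ b, b ≠ .y → ρ.arr b = σ.arr b

/-- One step of coordinate descent, as it appears in `coordinateDescent`. -/
def coordinateStep (n : ℕ) : Prog n :=
  .draw fun i =>
    .seq (.gradComp .g .y i)
      (.setEntry .y i
        (.sub (.entry .y i)
          (.mul (.div (.lit 1) (.add (.var .H) (.entry .L i)))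
            (.add (.var .g)
              (.mul (.var .H) (.sub (.entry .y i) (.entry .xt i)))))))

theorem coordinateDescent_eq (n N : ℕ) : coordinateDescent n N
    = .seq (.forCoords fun i => .setEntry .y i (.entry .xt i)) (.loop N (coordinateStep n)) := rfl

theorem ensures_coordinateStep_agrees {σ ρ : Config n} (h : σ.AgreesOffInner ρ) :
    Ensures ((coordinateStep n).run f τ (ρ.tick 1)) 0 σ.AgreesOffInner := by
  apply ensures_draw
  · exact ⟨h.scal, h.tab, h.arr⟩
  · intro i
    simp only [Prog.run, PMF.pure_bind]
    apply ensures_pure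
    refine ⟨fun r hr => ?_, h.tab, fun b hb => ?_⟩
    · simp [Config.tick, Config.setEntry, Config.setScal, Function.update_of_ne hr, h.scal r hr]
    · simp [Config.tick, Config.setEntry, Config.setScal, Function.update_of_ne hb, h.arr b hb]

theorem expect_coordinateStep {ρ : Config n} (h0 : ∀ i, 0 ≤ ρ.tab i) (h1 : ∑ i, ρ.tab i = 1)
    (φ : EuclideanSpace ℝ (Fin n) → ℝ≥0∞) :
    expect ((coordinateStep n).run f τ (ρ.tick 1)) (fun σ => φ (σ.point .y))
      = ∑ i, ENNReal.ofReal (ρ.tab i) * φ (ρ.point .y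
        + (-(1 / (ρ.scal .H + ρ.arr .L i)
          * proxGradient f (ρ.scal .H) (ρ.point .xt) (ρ.point .y) i))
            • EuclideanSpace.single i (1 : ℝ)) := by
  rw [coordinateStep, expect_draw (by exact h0) (by exact h1)]
  refine Finset.sum_congr rfl fun i _ => ?_
  simp only [Prog.run, PMF.pure_bind, expect_pure, Arith.value, Config.tick, Config.setEntry,
    Config.setScal, Config.point]
  rw [Function.update_self, ← toLp_update_sub]
  simp [proxGradient]

section

variable {H L Z : ℝ} {Lc : Fin n → ℝ}
  (hf : Differentiable ℝ f) (hc : ConvexOn ℝ Set.univ f) (hH : 0 < H)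
  (hLc0 : ∀ i, 0 ≤ Lc i)
  (hLc : ∀ (i : Fin n) (x : EuclideanSpace ℝ (Fin n)) (u : ℝ),
    |gradient f (x + u • EuclideanSpace.single i (1 : ℝ)) i - gradient f x i| ≤ Lc i * |u|)
  (hL0 : 0 ≤ L) (hL : ∀ x y, ‖gradient f x - gradient f y‖ ≤ L * ‖x - y‖)
  (hZ : Z = ∑ i, (H + Lc i)) (hHZ : H ≤ Z)

-- Minimality of w makes all gaps nonnegative, so `ENNReal.ofReal` commutes with the weighted sum
-- and the real estimate carries over.
include hf hc hH hLc0 hLc hZ hHZ in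
theorem expect_coordinateStep_gap_le {ρ : Config n} (hρH : ρ.scal .H = H) (hρL : ρ.arr .L = Lc)
    (hρt : ∀ i, ρ.tab i = (H + Lc i) / Z) {w : EuclideanSpace ℝ (Fin n)}
    (hw : ∀ y, proxObjective f H (ρ.point .xt) w ≤ proxObjective f H (ρ.point .xt) y) :
    expect ((coordinateStep n).run f τ (ρ.tick 1)) (fun σ => ENNReal.ofReal
        (proxObjective f H (ρ.point .xt) (σ.point .y) - proxObjective f H (ρ.point .xt) w))
      ≤ ENNReal.ofReal (1 - H / Z) * ENNReal.ofReal
        (proxObjective f H (ρ.point .xt) (ρ.point .y) - proxObjective f H (ρ.point .xt) w) := by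
  have hZ0 : 0 < Z := hH.trans_le hHZ
  have hp : ∀ i, 0 ≤ ρ.tab i := fun i => by
    rw [hρt]
    have := hLc0 i
    positivity
  have h1 : ∑ i, ρ.tab i = 1 := by
    simp only [hρt]
    rw [← Finset.sum_div, ← hZ, div_self hZ0.ne']
  rw [expect_coordinateStep hp h1 (fun y => ENNReal.ofReal
    (proxObjective f H (ρ.point .xt) y - proxObjective f H (ρ.point .xt) w))]
  simp only [← ENNReal.ofReal_mul (hp _)]
  rw [← ENNReal.ofReal_sum_of_nonneg fun i _ => mul_nonneg (hp i) (sub_nonneg.2 (hw _)),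
    ← ENNReal.ofReal_mul (sub_nonneg.2 ((div_le_one hZ0).2 hHZ))]
  apply ENNReal.ofReal_le_ofReal
  simp only [hρt, hρH, hρL]
  exact sum_proxObjective_step_le hf hc hH hLc0 hLc hZ hZ0 _ _ w

include hf hc hH hLc0 hLc hL0 hL hZ hHZ in
/-- Coordinate descent fails to produce a good approximate proximal point with small
probability. -/
theorem ensures_coordinateDescent {m : ℝ} (hm : ∀ x, m ≤ f x) {σ : Config n}
    (hσH : σ.scal .H = H) (hσL : σ.arr .L = Lc) (hσt : ∀ i, σ.tab i = (H + Lc i) / Z)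
    {N : ℕ} {b : ℝ} (hN : (1 - H / Z) ^ N * ((1 + L / H) * (3 + 2 * L / H) ^ 2) ≤ b) :
    Ensures ((coordinateDescent n N).run f τ σ) (ENNReal.ofReal b) fun ρ =>
      σ.AgreesOffInner ρ ∧
      ‖(1 / (2 * H)) • gradient f (ρ.point .y) + (ρ.point .y - σ.point .xt)‖
        ≤ ‖ρ.point .y - σ.point .xt‖ := by
  obtain ⟨w, hw⟩ := exists_proxObjective_min hf hH hm (σ.point .xt)
  rw [coordinateDescent_eq]
  refine Ensures.seq_of_zero (ensures_forCoords_setEntry .y _ σ ?_) ?_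
  · intro i ρ _ h _
    simp [Arith.value, h .xt (by decide)]
  rintro σ' ⟨h1, h2, h3⟩
  have hag : σ.AgreesOffInner σ' := by
    refine ⟨fun r _ => by rw [h1], h2, fun b hb => ?_⟩
    rw [h3, Function.update_of_ne hb]
  have hy : σ'.point .y = σ.point .xt := by
    simp [Config.point, h3, Arith.value]
  have hxt : ∀ {ρ : Config n}, σ.AgreesOffInner ρ → ρ.point .xt = σ.point .xt := fun h => by
    rw [Config.point, h.arr .xt (by decide), Config.point]
  set φ : Config n → ℝ≥0∞ := fun ρ => ENNReal.ofReal
    (proxObjective f H (σ.point .xt) (ρ.point .y) - proxObjective f H (σ.point .xt) w) with hφ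
  have hloop := ensures_loop (f := f) (τ := τ) (fun _ => σ.AgreesOffInner)
    (fun _ _ => ensures_coordinateStep_agrees) hag N
  have hexp : expect ((Prog.loop N (coordinateStep n)).run f τ σ') φ
      ≤ ENNReal.ofReal (1 - H / Z) ^ N * φ σ' := by
    refine expect_loop_le σ.AgreesOffInner (fun _ => ensures_coordinateStep_agrees) ?_ hag N
    intro ρ hρ
    have := expect_coordinateStep_gap_le (τ := τ) hf hc hH hLc0 hLc hZ hHZ (ρ := ρ) (w := w)
      ((hρ.scal .H (by decide)).trans hσH) ((hρ.arr .L (by decide)).trans hσL)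
      (fun i => by rw [hρ.tab, hσt]) (by rw [hxt hρ]; exact hw)
    rwa [hxt hρ] at this
  set K := (1 + L / H) * (3 + 2 * L / H) ^ 2 with hK
  have hK0 : 0 < K := by positivity
  set gap := proxObjective f H (σ.point .xt) (σ.point .xt) - proxObjective f H (σ.point .xt) w
    with hgap
  have hgap0 : 0 ≤ gap := sub_nonneg.2 (hw _)
  have hq : 0 ≤ 1 - H / Z := sub_nonneg.2 ((div_le_one (hH.trans_le hHZ)).2 hHZ)
  -- Markov's inequality at the level gap/K, where gap is the initial one because the loop starts at
  -- y = x̃.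
  have hmarkov := ensures_le_of_expect_le (q := (Prog.loop N (coordinateStep n)).run f τ σ')
    (φ := φ) (b := ENNReal.ofReal b) (θ := ENNReal.ofReal (gap / K)) (by
      refine hexp.trans ?_
      have hb : 0 ≤ b := le_trans (by positivity) hN
      simp only [hφ, hy, ← hgap]
      rw [← ENNReal.ofReal_pow hq, ← ENNReal.ofReal_mul (pow_nonneg hq N), ← ENNReal.ofReal_mul hb]
      apply ENNReal.ofReal_le_ofReal
      rw [← mul_div_assoc, le_div_iff₀ hK0]
      calc _ = (1 - H / Z) ^ N * K * gap := by ring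
        _ ≤ _ := by gcongr)
  rw [mul_zero] at hloop
  refine (hloop.and hmarkov).mono (by rw [zero_add]) fun ρ ⟨hρ, hle⟩ => ⟨hρ, ?_⟩
  refine norm_smul_gradient_add_le_of_gap_le hf hc hH hL0 hL hw ?_
  simp only [hφ] at hle
  rw [ENNReal.ofReal_le_ofReal_iff (by positivity), le_div_iff₀ hK0] at hle
  rw [← hK, mul_comm]
  exact hle

end

/-- The loop updates x in place but evaluates the gradient at v, which it never writes, so all
components belong to the same point. -/
theorem ensures_gradient_step (σ : Config n) :
    Ensures ((Prog.forCoords fun i => .seq (.gradComp .g .v i)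
      (.setEntry .x i (.sub (.entry .x i) (.mul (.var .a) (.var .g))))).run f τ σ) 0 fun ρ =>
      (∀ r, r ≠ .g → ρ.scal r = σ.scal r) ∧ ρ.tab = σ.tab ∧ (∀ b, b ≠ .x → ρ.arr b = σ.arr b) ∧
        ρ.point .x = σ.point .x - σ.scal .a • gradient f (σ.point .v) := by
  have := ensures_forCoords (f := f) (τ := τ) (σ := σ) (body := fun i => .seq (.gradComp .g .v i)
      (.setEntry .x i (.sub (.entry .x i) (.mul (.var .a) (.var .g)))))
    (fun l ρ => (∀ r, r ≠ .g → ρ.scal r = σ.scal r) ∧ ρ.tab = σ.tab ∧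
      (∀ b, b ≠ .x → ρ.arr b = σ.arr b) ∧
      (∀ i ∈ l, ρ.arr .x i = σ.arr .x i - σ.scal .a * gradient f (σ.point .v) i) ∧
      ∀ i ∉ l, ρ.arr .x i = σ.arr .x i)
    (by
      rintro l i ρ hi ⟨h1, h2, h3, h4, h5⟩
      simp only [Prog.run, PMF.pure_bind]
      apply ensures_pure
      refine ⟨fun r hr => ?_, h2, fun b hb => ?_, fun j hj => ?_, fun j hj => ?_⟩
      · simp [Config.tick, Config.setEntry, Config.setScal, Function.update_of_ne hr, h1 r hr]
      · simp [Config.tick, Config.setEntry, Config.setScal, Function.update_of_ne hb, h3 b hb]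
      · by_cases hji : j = i
        · subst hji
          simp [Config.tick, Config.setEntry, Config.setScal, Arith.value, h5 j hi,
            h1 .a (by decide), h3 .v (by decide), Config.point]
        · have : j ∈ l := by simpa [hji] using hj
          simp [Config.tick, Config.setEntry, Config.setScal, Function.update_of_ne hji, h4 j this]
      · simp only [List.mem_append, List.mem_singleton, not_or] at hj
        simp [Config.tick, Config.setEntry, Config.setScal, Function.update_of_ne hj.2, h5 j hj.1])
    (by simp)
  refine this.mono le_rfl fun ρ ⟨h1, h2, h3, h4, _⟩ => ⟨h1, h2, h3, ?_⟩
  ext i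
  simpa [Config.point] using h4 i (List.mem_finRange i)

/-- The invariant of the outer loop. -/
structure OuterInvariant (f : EuclideanSpace ℝ (Fin n) → ℝ) (H R : ℝ) (Lc : Fin n → ℝ)
    (xs : EuclideanSpace ℝ (Fin n)) (k : ℕ) (σ : Config n) : Prop where
  scal_H : σ.scal .H = H
  scal_lam : σ.scal .lam = 1 / (2 * H)
  arr_L : σ.arr .L = Lc
  tab : ∀ i, σ.tab i = (H + Lc i) / ∑ j, (H + Lc j)
  growth : 1 / (2 * H) / 4 * (k : ℝ) ^ 2 ≤ σ.scal .A
  potential : σ.scal .A * (f (σ.point .v) - f xs) + 1 / 2 * ‖σ.point .x - xs‖ ^ 2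
    ≤ 1 / 2 * R ^ 2

theorem OuterInvariant.tick {H R : ℝ} {Lc : Fin n → ℝ} {xs : EuclideanSpace ℝ (Fin n)} {k : ℕ}
    {σ : Config n} (h : OuterInvariant f H R Lc xs k σ) (t : ℕ) :
    OuterInvariant f H R Lc xs k (σ.tick t) :=
  ⟨h.scal_H, h.scal_lam, h.arr_L, h.tab, h.growth, h.potential⟩

theorem ensures_preliminaries {H : ℝ} {Lc : Fin n → ℝ} (x₀ xs : EuclideanSpace ℝ (Fin n)) :
    Ensures ((preliminaries n).run f τ (initial H Lc x₀)) 0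
      (OuterInvariant f H ‖x₀ - xs‖ Lc xs 0) := by
  rw [preliminaries]
  apply ensures_setScal_seq
  apply ensures_setScal_seq
  refine Ensures.seq_of_zero (ensures_forCoords_setEntry .v _ _ ?_) ?_
  · intro i ρ _ h _
    exact congrFun (h .x (by decide)) i
  rintro ρ₁ ⟨h1, -, h3⟩
  apply ensures_setScal_seq
  set ρ₂ := (ρ₁.setScal .Z ((Arith.lit 0 : Arith n).value ρ₁)).tick ((Arith.lit 0 : Arith n).cost + 1)
    with hρ₂
  have hH : ρ₂.scal .H = H := by
    simp [hρ₂, Config.tick, Config.setScal, h1, initial]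
  have hlam : ρ₂.scal .lam = 1 / (2 * H) := by
    simp [hρ₂, Config.tick, Config.setScal, h1, initial, Arith.value]
  have hA : ρ₂.scal .A = 0 := by
    simp [hρ₂, Config.tick, Config.setScal, h1, Arith.value]
  have hL : ρ₂.arr .L = Lc := by
    simp [hρ₂, Config.tick, Config.setScal, h3, initial]
  have hx : ρ₂.arr .x = x₀.ofLp := by
    simp [hρ₂, Config.tick, Config.setScal, h3, initial]
  have hZ : ρ₂.scal .Z = 0 := by
    simp [hρ₂, Config.tick, Config.setScal, Arith.value]
  clear_value ρ₂
  refine Ensures.seq_of_zero (ensures_forCoords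
    (fun l ρ => (∀ r, r ≠ .Z → ρ.scal r = ρ₂.scal r) ∧ ρ.arr = ρ₂.arr ∧
      ρ.scal .Z = (l.map fun i => H + Lc i).sum) ?_ (by simp [hZ])) ?_
  · rintro l i ρ - ⟨h1, h2, h3⟩
    rw [run_setScal]
    apply ensures_pure
    refine ⟨fun r hr => ?_, h2, ?_⟩
    · simp [Config.tick, Config.setScal, Function.update_of_ne hr, h1 r hr]
    · simp [Config.tick, Config.setScal, Arith.value, h3, h2, h1 .H (by decide), hH, hL]
  rintro ρ₃ ⟨h1, h2, h3⟩
  rw [← Fin.sum_univ_def] at h3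
  refine Ensures.seq_of_zero (ensures_forCoords_setEntry .p _ ρ₃ ?_) ?_
  · intro i ρ h h' _
    simp [Arith.value, h, h' .L (by decide)]
  rintro ρ₄ ⟨h4, -, h6⟩
  simp only [Prog.run]
  apply ensures_pure
  refine ⟨?_, ?_, ?_, fun i => ?_, ?_, ?_⟩
  · simp [Config.tick, h4, h1 .H (by decide), hH]
  · simp [Config.tick, h4, h1 .lam (by decide), hlam]
  · simp [Config.tick, h6, h2, hL]
  · simp [Config.tick, h6, Arith.value, h3, h2, hL, h1 .H (by decide), hH]
  · simp [Config.tick, h4, h1 .A (by decide), hA]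
  -- Since A = 0, the initial potential is just ½‖x₀ - xs‖².
  · simp [Config.tick, Config.point, h4, h1 .A (by decide), hA, h6, h2, hx]

theorem ensures_outerStep {H L R : ℝ} {Lc : Fin n → ℝ} {xs : EuclideanSpace ℝ (Fin n)}
    (hf : Differentiable ℝ f) (hc : ConvexOn ℝ Set.univ f) (hH : 0 < H)
    (hLc0 : ∀ i, 0 ≤ Lc i)
    (hLc : ∀ (i : Fin n) (x : EuclideanSpace ℝ (Fin n)) (u : ℝ),
      |gradient f (x + u • EuclideanSpace.single i (1 : ℝ)) i - gradient f x i| ≤ Lc i * |u|)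
    (hL0 : 0 ≤ L) (hL : ∀ x y, ‖gradient f x - gradient f y‖ ≤ L * ‖x - y‖)
    (hHZ : H ≤ ∑ i, (H + Lc i)) (hm : ∀ x, f xs ≤ f x) {N k : ℕ} {b : ℝ}
    (hN : (1 - H / ∑ i, (H + Lc i)) ^ N * ((1 + L / H) * (3 + 2 * L / H) ^ 2) ≤ b)
    {σ : Config n} (hσ : OuterInvariant f H R Lc xs k σ) :
    Ensures ((outerStep n N).run f τ σ) (ENNReal.ofReal b)
      (OuterInvariant f H R Lc xs (k + 1)) := by
  set lam := 1 / (2 * H) with hlam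
  have hlam0 : 0 < lam := by positivity
  set A := σ.scal .A with hA
  have hA0 : 0 ≤ A := le_trans (by positivity) hσ.growth
  set a := (lam + Real.sqrt (lam * lam + 4 * (lam * A))) / 2 with ha
  have ha0 : 0 < a := by positivity
  rw [outerStep]
  apply ensures_setScal_seq
  apply ensures_setScal_seq
  set σ₁ := Config.tick _ _ with hσ₁
  have h1H : σ₁.scal .H = H := by simp [hσ₁, Config.tick, Config.setScal, hσ.scal_H]
  have h1lam : σ₁.scal .lam = lam := by simp [hσ₁, Config.tick, Config.setScal, hσ.scal_lam, hlam]
  have h1A : σ₁.scal .A = A := by simp [hσ₁, Config.tick, Config.setScal, hA]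
  have h1a : σ₁.scal .a = a := by
    simp [hσ₁, Config.tick, Config.setScal, Arith.value, hσ.scal_lam, ← hA, ha, hlam]
  have h1n : σ₁.scal .Anew = A + a := by
    simp [hσ₁, Config.tick, Config.setScal, Arith.value, hσ.scal_lam, ← hA, ha, hlam]
  have h1arr : σ₁.arr = σ.arr := rfl
  have h1tab : σ₁.tab = σ.tab := rfl
  clear_value σ₁
  refine Ensures.seq_of_zero (ensures_forCoords_setEntry .xt _ σ₁ ?_) ?_
  · intro i ρ h h' _
    simp [Arith.value, h, h' .v (by decide), h' .x (by decide)]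
  rintro σ₂ ⟨h2s, h2t, h2a⟩
  have h2xt : (A + a) • σ₂.point .xt = A • σ.point .v + a • σ.point .x := by
    ext i
    have : A + a ≠ 0 := by positivity
    simp [Config.point, h2a, Arith.value, h1A, h1a, h1n, h1arr]
    field_simp
  -- Only coordinate descent is random, so it takes the whole failure budget and the rest of the
  -- step gets 0.
  rw [← add_zero (ENNReal.ofReal b)]
  refine Ensures.seq (ensures_coordinateDescent hf hc hH hLc0 hLc hL0 hL rfl hHZ hm
    (by rw [h2s, h1H]) (by simp [h2a, h1arr, hσ.arr_L]) (fun i => by rw [h2t, h1tab, hσ.tab]) hN) ?_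
  rintro σ₃ ⟨h3, h3y⟩
  refine Ensures.seq_of_zero (ensures_forCoords_setEntry .v _ σ₃ ?_) ?_
  · intro i ρ _ h _
    exact congrFun (h .y (by decide)) i
  rintro σ₄ ⟨h4s, h4t, h4a⟩
  refine Ensures.seq_of_zero (ensures_gradient_step σ₄) ?_
  rintro σ₅ ⟨h5s, h5t, h5a, h5x⟩
  rw [run_setScal]
  apply ensures_pure
  have h4v : σ₄.point .v = σ₃.point .y := by simp [Config.point, h4a, Arith.value]
  have h4x : σ₄.point .x = σ.point .x := by
    simp [Config.point, h4a, h3.arr .x (by decide), h2a, h1arr]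
  have e1 : ∀ r, r ≠ .g → σ₅.scal r = σ₁.scal r := fun r hr => by
    rw [h5s r hr, h4s, h3.scal r hr, h2s]
  have hpot := potential_le_of_norm_le (xs := xs) hf hc hA0 ha0 hlam0 (step_size_sq hlam0 hA0)
    h2xt h3y
  refine ⟨?_, ?_, ?_, fun i => ?_, ?_, ?_⟩
  · simp [Config.tick, Config.setScal, e1 .H (by decide), h1H]
  · simp [Config.tick, Config.setScal, e1 .lam (by decide), h1lam, hlam]
  · simp [Config.tick, Config.setScal, h5a .L (by decide), h4a, h3.arr .L (by decide), h2a, h1arr,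
      hσ.arr_L]
  · simp [Config.tick, Config.setScal, h5t, h4t, h3.tab, h2t, h1tab, hσ.tab]
  · refine (le_of_eq ?_).trans ((weight_growth hlam0 hσ.growth).trans (le_of_eq ?_))
    · push_cast
      rfl
    · simp [Config.tick, Config.setScal, Arith.value, e1 .Anew (by decide), h1n, ha, ← hA]
  · refine le_trans (le_of_eq ?_) (hpot.trans hσ.potential)
    have ev : ((σ₅.setScal .A ((Arith.var .Anew : Arith n).value σ₅)).tick
        ((Arith.var .Anew : Arith n).cost + 1)).point .v = σ₃.point .y := by
      rw [← h4v]
      simp [Config.point, Config.tick, Config.setScal, h5a .v (by decide)]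
    have ex : ((σ₅.setScal .A ((Arith.var .Anew : Arith n).value σ₅)).tick
        ((Arith.var .Anew : Arith n).cost + 1)).point .x
        = σ.point .x - a • gradient f (σ₃.point .y) := by
      rw [← h4v, ← h4x, ← h1a, ← e1 .a (by decide), h5s .a (by decide), ← h5x]
      rfl
    rw [ev, ex]
    simp [Config.tick, Config.setScal, Arith.value, e1 .Anew (by decide), h1n]

theorem ensures_metaAlgorithm {H L : ℝ} {Lc : Fin n → ℝ} {xs : EuclideanSpace ℝ (Fin n)}
    (hf : Differentiable ℝ f) (hc : ConvexOn ℝ Set.univ f) (hH : 0 < H)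
    (hLc0 : ∀ i, 0 ≤ Lc i)
    (hLc : ∀ (i : Fin n) (x : EuclideanSpace ℝ (Fin n)) (u : ℝ),
      |gradient f (x + u • EuclideanSpace.single i (1 : ℝ)) i - gradient f x i| ≤ Lc i * |u|)
    (hL0 : 0 ≤ L) (hL : ∀ x y, ‖gradient f x - gradient f y‖ ≤ L * ‖x - y‖)
    (hHZ : H ≤ ∑ i, (H + Lc i)) (hm : ∀ x, f xs ≤ f x) {M N : ℕ} {b : ℝ}
    (hN : (1 - H / ∑ i, (H + Lc i)) ^ N * ((1 + L / H) * (3 + 2 * L / H) ^ 2) ≤ b)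
    (x₀ : EuclideanSpace ℝ (Fin n)) :
    Ensures ((metaAlgorithm n M N).run f τ (initial H Lc x₀)) (M * ENNReal.ofReal b)
      (OuterInvariant f H ‖x₀ - xs‖ Lc xs M) :=
  Ensures.seq_of_zero (ensures_preliminaries x₀ xs) fun _ hρ =>
    ensures_loop (OuterInvariant f H ‖x₀ - xs‖ Lc xs)
      (fun _ _ h => ensures_outerStep hf hc hH hLc0 hLc hL0 hL hHZ hm hN (h.tick 1)) hρ M

theorem OuterInvariant.gap_le {H R : ℝ} {Lc : Fin n → ℝ} {xs : EuclideanSpace ℝ (Fin n)} {k : ℕ}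
    {σ : Config n} (h : OuterInvariant f H R Lc xs k σ) (hH : 0 < H) (hm : ∀ x, f xs ≤ f x) :
    (k : ℝ) ^ 2 * (f σ.output - f xs) ≤ 4 * H * R ^ 2 := by
  have h1 : 1 / (2 * H) / 4 * (k : ℝ) ^ 2 * (f (σ.point .v) - f xs) ≤ 1 / 2 * R ^ 2 := by
    refine (mul_le_mul_of_nonneg_right h.growth (sub_nonneg.2 (hm _))).trans ?_
    linarith [h.potential, sq_nonneg ‖σ.point .x - xs‖]
  -- 8H is the inverse of λ/4.
  have h2 := mul_le_mul_of_nonneg_left h1 (show 0 ≤ 8 * H by positivity)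
  have h3 : 8 * H * (1 / (2 * H) / 4 * (k : ℝ) ^ 2 * (f (σ.point .v) - f xs))
      = (k : ℝ) ^ 2 * (f σ.output - f xs) := by
    rw [Config.output, ← Config.point]
    field_simp
    ring
  linarith

end Algorithm

/-! ### The number of steps -/

section Steps

variable {n : ℕ} {f : EuclideanSpace ℝ (Fin n) → ℝ} {τ : EuclideanSpace ℝ (Fin n) → Fin n → ℕ}

/-- The number of steps of a program in the worst case, when a component of the gradient is
computed in `K` steps. -/
def Prog.maxSteps (K : ℕ) : Prog n → ℕ
  | .setScal _ e => e.cost + 1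
  | .setEntry _ _ e => e.cost + 1
  | .gradComp _ _ _ => K + 1
  | .tabulate _ => n
  | .draw body => 1 + Finset.univ.sup fun i => (body i).maxSteps K
  | .seq c d => c.maxSteps K + d.maxSteps K
  | .loop N c => N * (c.maxSteps K + 1)
  | .forCoords body => ∑ i, ((body i).maxSteps K + 1)

/-- The clock is compared with an arbitrary t rather than with its exact starting value, so that the
bound for one command feeds into the next. -/
theorem ensures_time_le {K : ℕ} (hτ : ∀ z i, τ z i ≤ K) (c : Prog n) :
    ∀ (σ : Config n) (t : ℕ), σ.time ≤ t →
      Ensures (c.run f τ σ) 0 fun ρ => ρ.time ≤ t + c.maxSteps K := by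
  induction c with
  | setScal r e =>
    intro σ t h
    simp only [Prog.run]
    exact ensures_pure _ (by simpa [Config.tick, Config.setScal, Prog.maxSteps] using h)
  | setEntry b i e =>
    intro σ t h
    simp only [Prog.run]
    exact ensures_pure _ (by simpa [Config.tick, Config.setEntry, Prog.maxSteps] using h)
  | gradComp r b i =>
    intro σ t h
    simp only [Prog.run]
    refine ensures_pure _ ?_
    have := hτ (WithLp.toLp 2 (σ.arr b)) i
    simp only [Config.tick, Config.setScal, Prog.maxSteps]
    omega
  | tabulate b =>
    intro σ t h
    simp only [Prog.run]
    exact ensures_pure _ (by simpa [Config.tick, Prog.maxSteps] using h)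
  | draw body ih =>
    intro σ t h
    apply ensures_draw
    · simp only [Config.tick, Prog.maxSteps]
      omega
    · intro i
      refine (ih i (σ.tick 1) (t + 1) (by simpa [Config.tick] using h)).mono le_rfl fun ρ hρ => ?_
      have : (body i).maxSteps K ≤ Finset.univ.sup fun i => (body i).maxSteps K :=
        Finset.le_sup (f := fun i => (body i).maxSteps K) (Finset.mem_univ i)
      simp only [Prog.maxSteps]
      omega
  | seq c d ihc ihd =>
    intro σ t h
    refine Ensures.seq_of_zero (ihc σ t h) fun ρ hρ => ?_
    simpa only [Prog.maxSteps, add_assoc] using ihd ρ _ hρ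
  | loop N c ih =>
    intro σ t h
    have := ensures_loop (f := f) (τ := τ) (c := c) (b := 0)
      (fun k ρ => ρ.time ≤ t + k * (c.maxSteps K + 1)) (fun k ρ hρ => by
        refine (ih (ρ.tick 1) (t + k * (c.maxSteps K + 1) + 1)
          (by simpa [Config.tick] using hρ)).mono le_rfl fun ρ' hρ' => ?_
        rw [add_mul, one_mul]
        omega) (σ := σ) (by simpa using h) N
    rwa [mul_zero] at this
  | forCoords body ih =>
    intro σ t h
    have := ensures_forCoords (f := f) (τ := τ) (body := body)
      (fun l ρ => ρ.time ≤ t + (l.map fun i => (body i).maxSteps K + 1).sum) (fun l i ρ _ hρ => by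
        refine (ih i (ρ.tick 1) (t + (l.map fun i => (body i).maxSteps K + 1).sum + 1)
          (by simpa [Config.tick] using hρ)).mono le_rfl fun ρ' hρ' => ?_
        rw [List.map_append, List.sum_append, List.map_singleton, List.sum_singleton]
        omega) (σ := σ) (by simpa using h)
    rwa [← Fin.sum_univ_def] at this

theorem maxSteps_metaAlgorithm_le (hn : 0 < n) (K M N : ℕ) :
    (metaAlgorithm n M N).maxSteps K ≤ 100 * (K + 1) * (n + M * (n + N)) := by
  have : Nonempty (Fin n) := ⟨⟨0, hn⟩⟩
  -- The exact count is 18n + 10, and n ≥ 1 absorbs the 10. The constant 100 below is not sharp.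
  have h1 : (preliminaries n).maxSteps K ≤ 28 * n := by
    simp [preliminaries, Prog.maxSteps, Arith.cost]
    omega
  have h2 : (outerStep n N).maxSteps K + 1 ≤ 100 * (K + 1) * (n + N) := by
    simp [outerStep, coordinateDescent, Prog.maxSteps, Arith.cost, Finset.sup_const]
    nlinarith [Nat.zero_le (K * n), Nat.zero_le (K * N)]
  have h3 : (metaAlgorithm n M N).maxSteps K
      = (preliminaries n).maxSteps K + M * ((outerStep n N).maxSteps K + 1) := rfl
  rw [h3]
  calc _ ≤ 100 * (K + 1) * n + M * (100 * (K + 1) * (n + N)) :=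
        add_le_add (h1.trans (by nlinarith [Nat.zero_le (K * n)])) (Nat.mul_le_mul_left _ h2)
    _ = _ := by ring

end Steps

/-! ### The numbers of iterations -/

/-- 48/5 is the square of 4√15/5; any constant above 4 would give the final strict inequality. -/
theorem le_outerIterations_sq {H R ε : ℝ} (hH : 0 < H) (hε : 0 < ε) :
    48 / 5 * (H * R ^ 2) ≤ (outerIterations H R ε : ℝ) ^ 2 * ε := by
  have h1 : 4 * Real.sqrt 15 / 5 * Real.sqrt (H * R ^ 2 / ε) ≤ outerIterations H R ε :=
    Nat.le_ceil _
  have h2 := pow_le_pow_left₀ (by positivity) h1 2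
  rw [mul_pow, div_pow, mul_pow, Real.sq_sqrt (by norm_num), Real.sq_sqrt (by positivity)] at h2
  have h3 := mul_le_mul_of_nonneg_right h2 hε.le
  refine le_trans (le_of_eq ?_) h3
  field_simp
  ring

theorem outerIterations_le {H R ε : ℝ} (h : 1 ≤ Real.sqrt (H * R ^ 2 / ε)) :
    (outerIterations H R ε : ℝ) ≤ 5 * Real.sqrt (H * R ^ 2 / ε) := by
  have h1 : Real.sqrt 15 ≤ 4 := Real.sqrt_le_iff.2 ⟨by norm_num, by norm_num⟩
  have h2 : (outerIterations H R ε : ℝ)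
      < 4 * Real.sqrt 15 / 5 * Real.sqrt (H * R ^ 2 / ε) + 1 :=
    Nat.ceil_lt_add_one (by positivity)
  nlinarith

/-- By 1 - H/Z ≤ exp(-H/Z), at least (Z/H) log Q steps contract by Q⁻¹, and Q is M/δ times the
factor that remains. -/
theorem innerIterations_spec {n : ℕ} {H L δ : ℝ} {Lc : Fin n → ℝ} {M : ℕ} (hH : 0 < H)
    (hL0 : 0 ≤ L) (hδ : 0 < δ) (hM : 0 < M) (hHZ : H ≤ ∑ i, (H + Lc i)) :
    (1 - H / ∑ i, (H + Lc i)) ^ innerIterations H L Lc M δ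
      * ((1 + L / H) * (3 + 2 * L / H) ^ 2) ≤ δ / M := by
  have hM' : (0 : ℝ) < M := Nat.cast_pos.2 hM
  set Z := ∑ i, (H + Lc i) with hZ
  have hZ0 : 0 < Z := hH.trans_le hHZ
  set Q := (M : ℝ) / δ * (1 + L / H) * (3 + 2 * L / H) ^ 2 with hQ
  have hQ0 : 0 < Q := by positivity
  have h1 : Z / H * Real.log Q ≤ innerIterations H L Lc M δ := Nat.le_ceil _
  have h2 : (1 - H / Z) ^ innerIterations H L Lc M δ ≤ Q⁻¹ := by
    calc _ ≤ Real.exp (-(H / Z)) ^ innerIterations H L Lc M δ :=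
          pow_le_pow_left₀ (sub_nonneg.2 ((div_le_one hZ0).2 hHZ)) (Real.one_sub_le_exp_neg _) _
      _ = Real.exp (-(H / Z * innerIterations H L Lc M δ)) := by
          rw [← Real.exp_nat_mul]
          congr 1
          ring
      _ ≤ Real.exp (-Real.log Q) := by
          refine Real.exp_le_exp.2 (neg_le_neg ?_)
          have h3 := mul_le_mul_of_nonneg_left h1 (show 0 ≤ H / Z by positivity)
          refine le_trans (le_of_eq ?_) h3
          field_simp
      _ = Q⁻¹ := by rw [Real.exp_neg, Real.exp_log hQ0]
  refine (mul_le_mul_of_nonneg_right h2 (by positivity)).trans (le_of_eq ?_)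
  rw [hQ]
  field_simp

theorem innerIterations_le {n : ℕ} {H L δ Λ : ℝ} {Lc : Fin n → ℝ} {M : ℕ} (hH : 0 < H)
    (hn : 0 < n) (hΛ : 1 ≤ Λ) (hZ : ∑ i, (H + Lc i) = 2 * n * H)
    (hlog : Real.log ((M : ℝ) / δ * (1 + L / H) * (3 + 2 * L / H) ^ 2) ≤ 2 * Λ) :
    (innerIterations H L Lc M δ : ℝ) ≤ 5 * (n * Λ) := by
  have hn' : (1 : ℝ) ≤ n := Nat.one_le_cast.2 hn
  have h1 : (∑ i, (H + Lc i)) / H * Real.log ((M : ℝ) / δ * (1 + L / H) * (3 + 2 * L / H) ^ 2)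
      ≤ 4 * (n * Λ) := by
    rw [hZ, mul_div_assoc, div_self hH.ne', mul_one]
    nlinarith
  have h2 : (innerIterations H L Lc M δ : ℝ) ≤ ⌈4 * (n * Λ)⌉₊ := Nat.cast_le.2 (Nat.ceil_le_ceil h1)
  have h3 := Nat.ceil_lt_add_one (show 0 ≤ 4 * (n * Λ) by positivity)
  nlinarith

/-- The logarithmic factor of the number of inner iterations, for small `ε`. -/
theorem log_factor_le {q G Q ε δ M : ℝ} (hG : 0 < G) (hε : 0 < ε) (hδ : 0 < δ) (hδ1 : δ < 1)
    (hM : 0 < M) (hMq : M ≤ 5 * (q / Real.sqrt ε)) (hQ : Q = M / δ * G)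
    (hsmall : 5 * q * G ≤ 1 / Real.sqrt ε) :
    Real.log Q ≤ 2 * Real.log (1 / (Real.sqrt ε * δ)) := by
  have hs : 0 < Real.sqrt ε := Real.sqrt_pos.2 hε
  -- One factor comes from M/δ; the other absorbs the constant 5qG, as ε is small and δ < 1.
  have h2 : Q ≤ (1 / (Real.sqrt ε * δ)) ^ 2 := by
    calc Q ≤ 5 * (q / Real.sqrt ε) / δ * G := by rw [hQ]; gcongr
      _ = (5 * q * G) * (1 / (Real.sqrt ε * δ)) := by field_simp
      _ ≤ (1 / (Real.sqrt ε * δ)) * (1 / (Real.sqrt ε * δ)) := by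
          gcongr
          refine hsmall.trans ?_
          gcongr
          exact mul_le_of_le_one_right hs.le hδ1.le
      _ = _ := by ring
  refine (Real.log_le_log (by rw [hQ]; positivity) h2).trans (le_of_eq ?_)
  rw [Real.log_pow]
  norm_num

theorem one_le_log_inv_sqrt_mul {ε δ : ℝ} (hε : 0 < ε) (hδ : 0 < δ) (hδ1 : δ < 1)
    (h : 3 ≤ 1 / Real.sqrt ε) : 1 ≤ Real.log (1 / (Real.sqrt ε * δ)) := by
  have hs : 0 < Real.sqrt ε := Real.sqrt_pos.2 hε
  rw [Real.le_log_iff_exp_le (by positivity)]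
  refine (Real.exp_one_lt_three.le.trans h).trans ?_
  gcongr
  exact mul_le_of_le_one_right hs.le hδ1.le

end AccMeta

/-! ### Choice of the constants and conclusion -/

theorem theorem5 (c : ℝ) :
    -- the constant in `O(·)` depends only on the constant `c` in the `O(s)` of the hypothesis
    ∃ C : ℝ, 0 < C ∧ ∀ L Lbar R : ℝ, 0 < Lbar → 0 < R → ∃ ε₀ : ℝ, 0 < ε₀ ∧
      ∀ (n : ℕ) (f : EuclideanSpace ℝ (Fin n) → ℝ) (Lc : Fin n → ℝ)
        (x₀ xstar : EuclideanSpace ℝ (Fin n))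
        (τ : EuclideanSpace ℝ (Fin n) → Fin n → ℕ) (s : ℕ),
        Differentiable ℝ f →
        ConvexOn ℝ Set.univ f →
        (∀ (i : Fin n) (x : EuclideanSpace ℝ (Fin n)) (u : ℝ),
          |gradient f (x + u • EuclideanSpace.single i (1 : ℝ)) i - gradient f x i|
            ≤ Lc i * |u|) →
        (∀ x y : EuclideanSpace ℝ (Fin n), ‖gradient f x - gradient f y‖ ≤ L * ‖x - y‖) →
        (∀ x : EuclideanSpace ℝ (Fin n), f xstar ≤ f x) →
        Lbar = (1 / (n : ℝ)) * ∑ i, Lc i →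
        R = ‖x₀ - xstar‖ →
        1 ≤ s →
        -- one component of the gradient of `f` is computed in `O(s)` steps
        (∀ (z : EuclideanSpace ℝ (Fin n)) (i : Fin n), (τ z i : ℝ) ≤ c * (s : ℝ)) →
        ∀ ε δ : ℝ, 0 < ε → 0 < δ → δ < 1 →
          -- the numbers of iterations and the law of the final memory, for the parameter `H = Lbar`
          ∀ (M N : ℕ) (law : PMF (AccMeta.Config n)),
          M = AccMeta.outerIterations Lbar R ε →
          N = AccMeta.innerIterations Lbar L Lc M δ →
          law = (AccMeta.metaAlgorithm n M N).run f τ (AccMeta.initial Lbar Lc x₀) →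
          -- the output is an `ε`-solution with probability at least `1 - δ`
          ENNReal.ofReal (1 - δ) ≤ law.toOuterMeasure {σ | f σ.output - f xstar < ε} ∧
          -- the number of steps of every run
          (ε < ε₀ → ∀ σ ∈ law.support,
            (σ.time : ℝ) ≤ C * ((s : ℝ) * (n : ℝ) * Real.sqrt (Lbar * R ^ 2 / ε)
              * Real.log (1 / (Real.sqrt ε * δ)))) := by
  set c₀ := max c 0 with hc₀
  have hc₀0 : 0 ≤ c₀ := le_max_right _ _
  -- 31 = 1 + 5·(1 + 5), from M ≤ 5r and N ≤ 5nΛ inserted in n + M(n + N).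
  refine ⟨100 * (c₀ + 1) * 31, by positivity, fun L Lbar R hH hR => ?_⟩
  set G := (1 + L / Lbar) * (3 + 2 * L / Lbar) ^ 2 with hG
  set q := Real.sqrt (Lbar * R ^ 2) with hq
  set D := max 3 (5 * q * G) with hD
  have hD0 : 0 < D := lt_of_lt_of_le (by norm_num) (le_max_left _ _)
  -- The first bound gives r ≥ 1. The second gives 1/√ε ≥ D, where 3 > e yields Λ ≥ 1 and 5qG is
  -- what `log_factor_le` requires.
  refine ⟨min (Lbar * R ^ 2) ((1 / D) ^ 2), lt_min (by positivity) (by positivity), ?_⟩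
  intro n f Lc x₀ xs τ s hf hc hLc hL hm hLbar hRx hs hτ ε δ hε hδ hδ1 M N law hM hN hlaw
  -- The sign of L follows from the Lipschitz bound at the distinct points x₀ and xs.
  have hL0 : 0 ≤ L := by
    have h1 := (norm_nonneg _).trans (hL x₀ xs)
    rw [← hRx] at h1
    exact nonneg_of_mul_nonneg_left h1 hR
  have hLc0 : ∀ i, 0 ≤ Lc i := fun i => by
    have h1 := (abs_nonneg _).trans (hLc i 0 1)
    simpa using h1
  have hn : 0 < n := by
    rcases Nat.eq_zero_or_pos n with rfl | h
    · simp at hLbar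
      exact absurd hLbar hH.ne'
    · exact h
  have hn' : (1 : ℝ) ≤ n := Nat.one_le_cast.2 hn
  have hZ : ∑ i, (Lbar + Lc i) = 2 * n * Lbar := by
    rw [Finset.sum_add_distrib, Finset.sum_const, Finset.card_univ, Fintype.card_fin, nsmul_eq_mul]
    have h1 : ∑ i, Lc i = n * Lbar := by
      rw [hLbar, one_div, mul_inv_cancel_left₀ (by positivity)]
    rw [h1]
    ring
  have hHZ : Lbar ≤ ∑ i, (Lbar + Lc i) := by
    rw [hZ]
    nlinarith
  have hMsq := AccMeta.le_outerIterations_sq (R := R) hH hε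
  rw [← hM] at hMsq
  have hHR : 0 < Lbar * R ^ 2 := by positivity
  have hM0 : 0 < M := by
    rcases Nat.eq_zero_or_pos M with rfl | h
    · simp at hMsq
      linarith
    · exact h
  have hM0' : (0 : ℝ) < M := Nat.cast_pos.2 hM0
  constructor
  · have hens := AccMeta.ensures_metaAlgorithm (τ := τ) (M := M) hf hc hH hLc0 hLc hL0 hL hHZ hm
      (AccMeta.innerIterations_spec (δ := δ) hH hL0 hδ hM0 hHZ) x₀
    rw [← hN, ← hlaw, ← hRx, ← ENNReal.ofReal_natCast, ← ENNReal.ofReal_mul hM0'.le,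
      mul_div_cancel₀ _ hM0'.ne'] at hens
    rw [ENNReal.ofReal_sub _ hδ.le, ENNReal.ofReal_one]
    refine AccMeta.one_sub_le_of_ensures (hens.mono le_rfl fun σ hσ => ?_)
    have hgap := hσ.gap_le hH hm
    -- A gap of at least ε would give (48/5)L̄R² ≤ M²ε ≤ 4L̄R².
    by_contra! hge
    have := mul_le_mul_of_nonneg_left hge (sq_nonneg (M : ℝ))
    linarith
  · intro hεs σ hσ
    have hε1 : ε ≤ Lbar * R ^ 2 := hεs.le.trans (min_le_left _ _)
    have hsε : 0 < Real.sqrt ε := Real.sqrt_pos.2 hε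
    have hDε : D ≤ 1 / Real.sqrt ε := by
      have h1 : Real.sqrt ε ≤ 1 / D :=
        Real.sqrt_le_iff.2 ⟨by positivity, hεs.le.trans (min_le_right _ _)⟩
      rwa [le_div_comm₀ hD0 hsε]
    set Λ := Real.log (1 / (Real.sqrt ε * δ)) with hΛ
    set r := Real.sqrt (Lbar * R ^ 2 / ε) with hr
    have hΛ1 : 1 ≤ Λ :=
      AccMeta.one_le_log_inv_sqrt_mul hε hδ hδ1 ((le_max_left _ _).trans hDε)
    have hr1 : 1 ≤ r := Real.one_le_sqrt.2 ((one_le_div hε).2 hε1)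
    have hMr : (M : ℝ) ≤ 5 * r := hM ▸ AccMeta.outerIterations_le hr1
    have hNΛ : (N : ℝ) ≤ 5 * (n * Λ) := by
      rw [hN]
      refine AccMeta.innerIterations_le hH hn hΛ1 hZ ?_
      refine AccMeta.log_factor_le (q := q) (G := G) (M := M) (by positivity) hε hδ hδ1 hM0' ?_
        (by rw [hG]; ring) ((le_max_right _ _).trans hDε)
      rwa [hq, ← Real.sqrt_div' _ hε.le]
    have hK : ∀ z i, τ z i ≤ ⌊c₀ * s⌋₊ := fun z i => Nat.le_floor
      ((hτ z i).trans (mul_le_mul_of_nonneg_right (le_max_left _ _) (Nat.cast_nonneg _)))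
    have htime := AccMeta.ensures_zero_iff.1 (AccMeta.ensures_time_le (f := f) hK
      (AccMeta.metaAlgorithm n M N) (AccMeta.initial Lbar Lc x₀) 0 le_rfl) σ (hlaw ▸ hσ)
    rw [zero_add] at htime
    have hsteps : (σ.time : ℝ) ≤ 100 * (⌊c₀ * s⌋₊ + 1) * (n + M * (n + N)) := by
      exact_mod_cast htime.trans (AccMeta.maxSteps_metaAlgorithm_le hn _ M N)
    have hs' : (1 : ℝ) ≤ s := Nat.one_le_cast.2 hs
    have hfl : (⌊c₀ * s⌋₊ : ℝ) ≤ c₀ * s := Nat.floor_le (by positivity)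
    have h1 : (1 : ℝ) ≤ r * Λ := one_le_mul_of_one_le_of_one_le hr1 hΛ1
    calc (σ.time : ℝ) ≤ 100 * (⌊c₀ * s⌋₊ + 1) * (n + M * (n + N)) := hsteps
      _ ≤ 100 * (c₀ * s + s) * (n * (r * Λ) + 5 * r * (n * Λ + 5 * (n * Λ))) := by
          gcongr
          · exact le_mul_of_one_le_right (by positivity) h1
          · exact le_mul_of_one_le_right (by positivity) hΛ1
      _ = _ := by ring
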